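/- **Setting.** Let $\mathcal A=\mathbb Z[v,v^{-1}]$ and $q=v^2$. For a Coxeter system $(W,S)$ with length function $\ell$ and Bruhat order $\le$, and for $p\in\{q,q^2\}$, the Hecke algebra of $(W,S)$ with parameter $p$ is the $\mathcal A$-algebra that is free as an $\mathcal A$-module on a basis indexed by $W$ (written $(t_w)_{w\in W}$ in the algebra $\mathcal H_q$ and $(T_w)_{w\in W}$ in the algebra $\mathcal H_{q^2}$) with, for $s\in S$ and $w\in W$, $$T_sT_w=T_{sw}\ \text{ if } sw>w,\qquad T_sT_w=p\,T_{sw}+(p-1)T_w\ \text{ if } sw<w .$$ Its bar operator is the additive map with $\overline{v^nT_w}=v^{-n}(T_{w^{-1}})^{-1}$. For $w\in W$, the Kazhdan–Lusztig polynomials $(P_{y,w})_{y\in W}\subset\mathbb Z[q]$ are the unique family such that $c_w=v^{-\ell(w)}\sum_yP_{y,w}\,t_y\in\mathcal H_q$ satisfies $\overline{c_w}=c_w$, $P_{y,w}=\delta_{y,w}$ if $y\not<w$, and $\deg_q P_{y,w}\le\frac12(\ell(w)-\ell(y)-1)$ if $y<w$. Let $*$ be an automorphism of $W$ of order at most two with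 $S^*=S$, put $\mathbf I_*=\{w\in W: w^*=w^{-1}\}$, and for $s\in S$, $w\in\mathbf I_*$ let $s\ltimes w=sw$ if $sws^*=w$ and $s\ltimes w=sws^*$ otherwise. Let $\mathcal M_{q^2}$ be the free $\mathcal A$-module with basis $(a_w)_{w\in\mathbf I_*}$, with the unique $\mathcal H_{q^2}$-module structure such that $$T_sa_w=\begin{cases}a_{s\ltimes w}&\text{if } s\ltimes w=sws^*>w,\\(q+1)a_{s\ltimes w}+q\,a_w&\text{if } s\ltimes w=sw>w,\\(q^2-q)a_{s\ltimes w}+(q^2-q-1)a_w&\text{if } s\ltimes w=sw<w,\\q^2a_{s\ltimes w}+(q^2-1)a_w&\text{if } s\ltimes w=sws^*<w.\end{cases}$$ Its bar operator is the unique $\mathbb Z$-linear involution of $\mathcal M_{q^2}$ with $\overline{a_1}=a_1$ and $\overline{h\cdot m}=\overline h\cdot\overline m$ for all $h\in\mathcal H_{q^2}$, $m\in\mathcal M_{q^2}$. For $w\in\mathbf I_*$, the twisted Kazhdan–Lusztig polynomials $(P^\sigma_{y,w})_{y\in\mathbf I_*}\subset\mathbb Z[q]$ are the unique family such that $A_w=v^{-\ell(w)}\sum_yP^\sigma_{y,w}\,a_y$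 satisfies $\overline{A_w}=A_w$, $P^\sigma_{y,w}=\delta_{y,w}$ if $y\not<w$, and $\deg_q P^\sigma_{y,w}\le\frac12(\ell(w)-\ell(y)-1)$ if $y<w$. **Proposition.** Let $(W',S')$ be a Coxeter system and let $(W,S)=(W',S')\times(W',S')$, that is, $W=W'\times W'$ and $S=\{(s,1):s\in S'\}\cup\{(1,s):s\in S'\}$. Let $(x,y)^*=(y,x)$ for $x,y\in W'$. Let $\mathcal H'_{q^2}$ be the Hecke algebra of $(W',S')$ with parameter $q^2$, and let $\iota:\mathcal H'_{q^2}\to\mathcal H_{q^2}$ and $\iota^\sigma:\mathcal H'_{q^2}\to\mathcal M_{q^2}$ be the $\mathcal A$-linear maps with $\iota(T_w)=T_{(w,1)}$ and $\iota^\sigma(T_w)=a_{(w,w^{-1})}$ for $w\in W'$. Then the $\mathcal H_{q^2}$-module structure and the bar operator of $\mathcal M_{q^2}$, the Kazhdan–Lusztig polynomials of $(W',S')$ and the twisted Kazhdan–Lusztig polynomials of $(W,S,*)$ described above exist and are unique, and the following holds. (a) The map $\iota$ is injective, the map $\iota^\sigma$ is bijective, and for all $T,T'\in\mathcal H'_{q^2}$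 $$\iota(TT')=\iota(T)\,\iota(T'),\qquad \iota^\sigma(TT')=\iota(T)\cdot\iota^\sigma(T'),\qquad \iota^\sigma(\overline T)=\overline{\iota^\sigma(T)} .$$ (b) For all $y,w\in W'$, $\;P^\sigma_{(y,y^{-1}),(w,w^{-1})}=P_{y,w}(q^2)$. -/

import Mathlib

/-- The Coxeter matrix of a direct product: the two given matrices as diagonal blocks, and the
entry `2` (commuting generators) off these blocks. -/
def CoxeterMatrix.directSum {B₁ B₂ : Type*} (M₁ : CoxeterMatrix B₁) (M₂ : CoxeterMatrix B₂) :
    CoxeterMatrix (B₁ ⊕ B₂) where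
  M := Matrix.fromBlocks M₁.M (Matrix.of fun _ _ => 2) (Matrix.of fun _ _ => 2) M₂.M
  isSymm := by
    ext i j
    rcases i with i | i <;> rcases j with j | j
    · exact M₁.symmetric j i
    · rfl
    · rfl
    · exact M₂.symmetric j i
  diagonal i := by
    rcases i with i | i
    · exact M₁.diagonal i
    · exact M₂.diagonal i
  off_diagonal i j h := by
    rcases i with i | i <;> rcases j with j | j
    · exact M₁.off_diagonal i j (fun e => h (congrArg _ e))
    · simp
    · simp
    · exact M₂.off_diagonal i j (fun e => h (congrArg _ e))

namespace CoxeterSystem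

section DirectProduct

variable {B₁ B₂ W₁ W₂ : Type*} [Group W₁] [Group W₂] {M₁ : CoxeterMatrix B₁}
  {M₂ : CoxeterMatrix B₂} (cs₁ : CoxeterSystem M₁ W₁) (cs₂ : CoxeterSystem M₂ W₂)

/-- The generators `(s, 1)` and `(1, s)` of the direct product. -/
def prodSimple : B₁ ⊕ B₂ → W₁ × W₂ :=
  Sum.elim (fun i => (cs₁.simple i, 1)) (fun j => (1, cs₂.simple j))

theorem prodSimple_isLiftable : (M₁.directSum M₂).IsLiftable (prodSimple cs₁ cs₂) := by
  intro i j
  rcases i with i | i <;> rcases j with j | j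
  · refine Prod.ext ?_ ?_
    · exact cs₁.simple_mul_simple_pow i j
    · simp [prodSimple]
  · change _ ^ 2 = _
    refine Prod.ext ?_ ?_ <;> simp [prodSimple]
  · change _ ^ 2 = _
    refine Prod.ext ?_ ?_ <;> simp [prodSimple]
  · refine Prod.ext ?_ ?_
    · simp [prodSimple]
    · exact cs₂.simple_mul_simple_pow i j

theorem directSum_inl_isLiftable :
    M₁.IsLiftable (fun i : B₁ => (M₁.directSum M₂).simple (Sum.inl i)) := fun i j =>
  (M₁.directSum M₂).toCoxeterSystem.simple_mul_simple_pow (Sum.inl i) (Sum.inl j)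

theorem directSum_inr_isLiftable :
    M₂.IsLiftable (fun j : B₂ => (M₁.directSum M₂).simple (Sum.inr j)) := fun i j =>
  (M₁.directSum M₂).toCoxeterSystem.simple_mul_simple_pow (Sum.inr i) (Sum.inr j)

theorem directSum_commute (i : B₁) (j : B₂) :
    Commute ((M₁.directSum M₂).simple (Sum.inl i)) ((M₁.directSum M₂).simple (Sum.inr j)) := by
  have h : ((M₁.directSum M₂).simple (Sum.inl i) * (M₁.directSum M₂).simple (Sum.inr j)) ^ 2 = 1 :=
    (M₁.directSum M₂).toCoxeterSystem.simple_mul_simple_pow (Sum.inl i) (Sum.inr j)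
  have h1 : (M₁.directSum M₂).simple (Sum.inl i) * (M₁.directSum M₂).simple (Sum.inl i) = 1 :=
    (M₁.directSum M₂).toCoxeterSystem.simple_mul_simple_self (Sum.inl i)
  have h2 : (M₁.directSum M₂).simple (Sum.inr j) * (M₁.directSum M₂).simple (Sum.inr j) = 1 :=
    (M₁.directSum M₂).toCoxeterSystem.simple_mul_simple_self (Sum.inr j)
  rw [pow_two, mul_eq_one_iff_eq_inv, mul_inv_rev, inv_eq_of_mul_eq_one_left h1,
    inv_eq_of_mul_eq_one_left h2] at h
  exact h

theorem directSum_lift_commute (x : W₁) (y : W₂) :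
    Commute (cs₁.lift ⟨_, directSum_inl_isLiftable (M₁ := M₁) (M₂ := M₂)⟩ x)
      (cs₂.lift ⟨_, directSum_inr_isLiftable (M₁ := M₁) (M₂ := M₂)⟩ y) := by
  induction x using cs₁.simple_induction with
  | simple i =>
    induction y using cs₂.simple_induction with
    | simple j =>
      rw [lift_apply_simple, lift_apply_simple]
      exact directSum_commute i j
    | one => rw [map_one]; exact Commute.one_right _
    | mul a b ha hb => rw [map_mul]; exact ha.mul_right hb
  | one => rw [map_one]; exact Commute.one_left _
  | mul a b ha hb => rw [map_mul]; exact ha.mul_left hb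

/-- The direct product of two Coxeter systems: the group `W₁ × W₂` with the generators `(s, 1)`
and `(1, s)`. -/
def directProd : CoxeterSystem (M₁.directSum M₂) (W₁ × W₂) where
  mulEquiv := MonoidHom.toMulEquiv
    (MonoidHom.noncommCoprod (cs₁.lift ⟨_, directSum_inl_isLiftable (M₁ := M₁) (M₂ := M₂)⟩)
      (cs₂.lift ⟨_, directSum_inr_isLiftable (M₁ := M₁) (M₂ := M₂)⟩)
      (directSum_lift_commute cs₁ cs₂))
    ((M₁.directSum M₂).toCoxeterSystem.lift ⟨_, prodSimple_isLiftable cs₁ cs₂⟩)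
    (by
      have h1 : ((M₁.directSum M₂).toCoxeterSystem.lift ⟨_, prodSimple_isLiftable cs₁ cs₂⟩).comp
          (cs₁.lift ⟨_, directSum_inl_isLiftable (M₁ := M₁) (M₂ := M₂)⟩) = MonoidHom.inl W₁ W₂ := by
        refine cs₁.ext_simple fun i => ?_
        rw [MonoidHom.comp_apply, lift_apply_simple]
        exact (M₁.directSum M₂).toCoxeterSystem.lift_apply_simple
          (prodSimple_isLiftable cs₁ cs₂) (Sum.inl i)
      have h2 : ((M₁.directSum M₂).toCoxeterSystem.lift ⟨_, prodSimple_isLiftable cs₁ cs₂⟩).comp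
          (cs₂.lift ⟨_, directSum_inr_isLiftable (M₁ := M₁) (M₂ := M₂)⟩) = MonoidHom.inr W₁ W₂ := by
        refine cs₂.ext_simple fun i => ?_
        rw [MonoidHom.comp_apply, lift_apply_simple]
        exact (M₁.directSum M₂).toCoxeterSystem.lift_apply_simple
          (prodSimple_isLiftable cs₁ cs₂) (Sum.inr i)
      refine MonoidHom.ext fun ⟨x, y⟩ => ?_
      have e1 := DFunLike.congr_fun h1 x
      have e2 := DFunLike.congr_fun h2 y
      rw [MonoidHom.comp_apply] at e1 e2
      rw [MonoidHom.comp_apply, MonoidHom.noncommCoprod_apply, map_mul, e1, e2]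
      simp)
    (by
      refine (M₁.directSum M₂).toCoxeterSystem.ext_simple fun i => ?_
      rw [MonoidHom.comp_apply, lift_apply_simple]
      rcases i with i | i
      · simp [prodSimple]
      · simp [prodSimple])

theorem directProd_simple : (directProd cs₁ cs₂).simple = prodSimple cs₁ cs₂ :=
  funext fun i => (M₁.directSum M₂).toCoxeterSystem.lift_apply_simple
    (prodSimple_isLiftable cs₁ cs₂) i

end DirectProduct

end CoxeterSystem

namespace CoxeterSystem

variable {B W : Type*} [Group W] {M : CoxeterMatrix B} (cs : CoxeterSystem M W)

section Exchange

open Classical in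
/-- The map `(t, ε) ↦ (s t s, ε + [t = s])`, by which reflections and signs are permuted. -/
noncomputable def signedReflStep (i : B) : Function.End (W × ZMod 2) := fun x =>
  (cs.simple i * x.1 * cs.simple i, x.2 + if x.1 = cs.simple i then 1 else 0)

theorem signedReflStep_pow (i j : B) (n : ℕ) (t : W) (ε : ZMod 2) :
    ((cs.signedReflStep i * cs.signedReflStep j) ^ n) (t, ε) =
      ((cs.simple i * cs.simple j) ^ n * t * ((cs.simple i * cs.simple j) ^ n)⁻¹,
        ε + ∑ k ∈ Finset.range (2 * n),
          open Classical in if t = ((cs.simple i * cs.simple j) ^ k)⁻¹ * cs.simple j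
            then (1 : ZMod 2) else 0) := by
  classical
  induction n with
  | zero =>
    rw [pow_zero, pow_zero]
    change (t, ε) = _
    simp
  | succ n ih =>
    have hd : ∀ k : ℕ, cs.simple j * (cs.simple i * cs.simple j) ^ k =
        ((cs.simple i * cs.simple j) ^ k)⁻¹ * cs.simple j := by
      intro k
      induction k with
      | zero => simp
      | succ k ihk =>
        rw [pow_succ, ← mul_assoc, ihk, ← pow_succ, pow_succ', mul_inv_rev, mul_inv_rev]
        simp [mul_assoc]
    rw [pow_succ', show 2 * (n + 1) = 2 * n + 1 + 1 by ring, Finset.sum_range_succ,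
      Finset.sum_range_succ]
    change cs.signedReflStep i (cs.signedReflStep j
      (((cs.signedReflStep i * cs.signedReflStep j) ^ n) (t, ε))) = _
    rw [ih]
    set d := cs.simple i * cs.simple j with hdd
    have e1 : (d ^ n * t * (d ^ n)⁻¹ = cs.simple j) ↔ t = (d ^ (2 * n))⁻¹ * cs.simple j := by
      rw [mul_inv_eq_iff_eq_mul, hd n, two_mul, pow_add, mul_inv_rev, mul_assoc]
      exact eq_inv_mul_iff_mul_eq.symm
    have e2 : (cs.simple j * (d ^ n * t * (d ^ n)⁻¹) * cs.simple j = cs.simple i) ↔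
        t = (d ^ (2 * n + 1))⁻¹ * cs.simple j := by
      have h3 : cs.simple j * cs.simple i = d⁻¹ := by simp [hdd]
      have h4 : (cs.simple j * (d ^ n * t * (d ^ n)⁻¹) * cs.simple j = cs.simple i) ↔
          d ^ n * t * (d ^ n)⁻¹ = d⁻¹ * cs.simple j := by
        rw [← h3]
        constructor
        · intro h
          rw [← h]; simp [mul_assoc]
        · intro h
          rw [h]; simp [mul_assoc]
      have h5 : (d ^ (2 * n + 1))⁻¹ = (d ^ n)⁻¹ * (d⁻¹ * (d ^ n)⁻¹) := by
        rw [show 2 * n + 1 = n + 1 + n by ring, pow_add, pow_add, pow_one, mul_inv_rev, mul_inv_rev]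
      rw [h4, mul_inv_eq_iff_eq_mul, mul_assoc d⁻¹, hd n, h5, ← eq_inv_mul_iff_mul_eq]
      simp only [mul_assoc]
    refine Prod.ext ?_ ?_
    · simp only [signedReflStep]
      rw [pow_succ' d n, hdd]
      simp [mul_assoc]
    · simp only [signedReflStep]
      simp only [e1, e2]
      ring

theorem signedReflStep_isLiftable : M.IsLiftable cs.signedReflStep := by
  classical
  intro i j
  funext ⟨t, ε⟩
  rw [signedReflStep_pow, cs.simple_mul_simple_pow]
  change _ = (t, ε)
  refine Prod.ext (by simp) ?_
  simp only [two_mul, Finset.sum_range_add, pow_add, cs.simple_mul_simple_pow, one_mul]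
  rw [← two_mul, show (2 : ZMod 2) = 0 from rfl]
  simp

/-- The action of `W` on pairs of a group element and a sign. -/
noncomputable def signedReflHom : W →* Function.End (W × ZMod 2) :=
  cs.lift ⟨_, cs.signedReflStep_isLiftable⟩

theorem signedReflHom_simple (i : B) : cs.signedReflHom (cs.simple i) = cs.signedReflStep i :=
  cs.lift_apply_simple cs.signedReflStep_isLiftable i

theorem signedReflHom_snd (w t : W) (ε : ZMod 2) :
    (cs.signedReflHom w (t, ε)).2 = ε + (cs.signedReflHom w (t, 0)).2 := by
  obtain ⟨ω, rfl⟩ := cs.wordProd_surjective w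
  have key : ∀ (ω : List B), (cs.signedReflHom (cs.wordProd ω) (t, ε)).2 =
      ε + (cs.signedReflHom (cs.wordProd ω) (t, 0)).2 ∧
      (cs.signedReflHom (cs.wordProd ω) (t, ε)).1 =
      (cs.signedReflHom (cs.wordProd ω) (t, 0)).1 := by
    intro ω
    induction ω with
    | nil =>
      rw [wordProd_nil, map_one]
      change ε = ε + 0 ∧ t = t
      simp
    | cons i ω ih =>
      rw [wordProd_cons, map_mul, signedReflHom_simple]
      change (cs.signedReflStep i (cs.signedReflHom (cs.wordProd ω) (t, ε))).2 =
        ε + (cs.signedReflStep i (cs.signedReflHom (cs.wordProd ω) (t, 0))).2 ∧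
        (cs.signedReflStep i (cs.signedReflHom (cs.wordProd ω) (t, ε))).1 =
        (cs.signedReflStep i (cs.signedReflHom (cs.wordProd ω) (t, 0))).1
      simp only [signedReflStep]
      rw [ih.2, ih.1, add_assoc]
      exact ⟨rfl, rfl⟩
  exact (key ω).1

theorem signedReflHom_wordProd (ω : List B) (t : W) :
    (cs.signedReflHom (cs.wordProd ω) (t, 0)).1 = cs.wordProd ω * t * (cs.wordProd ω)⁻¹ ∧
    (t ∉ cs.rightInvSeq ω → (cs.signedReflHom (cs.wordProd ω) (t, 0)).2 = 0) := by
  induction ω with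
  | nil =>
    rw [wordProd_nil, map_one]
    change t = _ ∧ (_ → (0 : ZMod 2) = 0)
    simp
  | cons i ω ih =>
    rw [wordProd_cons, map_mul, signedReflHom_simple]
    change (cs.signedReflStep i (cs.signedReflHom (cs.wordProd ω) (t, 0))).1 = _ ∧
      (_ → (cs.signedReflStep i (cs.signedReflHom (cs.wordProd ω) (t, 0))).2 = 0)
    simp only [signedReflStep, ih.1, rightInvSeq, List.mem_cons, not_or]
    refine ⟨by simp [mul_assoc], fun h => ?_⟩
    rw [ih.2 h.2, if_neg, add_zero]
    intro e
    apply h.1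
    rw [← e, ih.1]
    simp [mul_assoc]

/-- A simple right descent of the element expressed by a word occurs in the right inversion
sequence of that word. -/
theorem simple_mem_rightInvSeq {ω : List B} {j : B}
    (h : cs.IsRightDescent (cs.wordProd ω) j) : cs.simple j ∈ cs.rightInvSeq ω := by
  by_contra hn
  obtain ⟨ω', hω', hw'⟩ := cs.exists_isReduced (cs.wordProd ω * cs.simple j)
  have h0 := (cs.signedReflHom_wordProd ω (cs.simple j)).2 hn
  have h1 : (cs.signedReflHom (cs.wordProd ω') (cs.simple j, 0)).2 = 1 := by
    rw [← hw', map_mul, signedReflHom_simple]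
    change (cs.signedReflHom (cs.wordProd ω) (cs.signedReflStep j (cs.simple j, 0))).2 = 1
    have : cs.signedReflStep j (cs.simple j, 0) = (cs.simple j, 1) := by
      simp [signedReflStep]
    rw [this, signedReflHom_snd, h0, add_zero]
  have hmem : cs.simple j ∈ cs.rightInvSeq ω' := by
    by_contra hn'
    rw [(cs.signedReflHom_wordProd ω' (cs.simple j)).2 hn'] at h1
    exact zero_ne_one h1
  have h2 := (cs.isRightInversion_of_mem_rightInvSeq hω' hmem).2
  rw [← hw', simple_mul_simple_cancel_right] at h2
  exact absurd h (by unfold IsRightDescent; omega)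

/-- If `sw > w` and `wt > w` but `swt < sw`, then `sw = wt`. -/
theorem simple_mul_eq_mul_simple {w : W} {i j : B} (hi : ¬ cs.IsLeftDescent w i)
    (hj : ¬ cs.IsRightDescent w j) (hij : cs.IsRightDescent (cs.simple i * w) j) :
    cs.simple i * w = w * cs.simple j := by
  obtain ⟨ω, hω, rfl⟩ := cs.exists_isReduced w
  rw [← wordProd_cons] at hij
  have h := cs.simple_mem_rightInvSeq hij
  rw [rightInvSeq, List.mem_cons] at h
  rcases h with h | h
  · rw [h]; simp [mul_assoc]
  · exact absurd (cs.isRightInversion_of_mem_rightInvSeq hω h).2 hj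

end Exchange

end CoxeterSystem

section HeckeAlgebra

variable {B W : Type*} [Group W] {M : CoxeterMatrix B} (cs : CoxeterSystem M W)
  {R : Type*} [CommRing R] (p : R)

namespace CoxeterSystem

open Classical in
/-- Left multiplication by `T_s`, as an operator on the free module on `W`. -/
noncomputable def heckeLeft (i : B) : (W →₀ R) →ₗ[R] (W →₀ R) :=
  Finsupp.linearCombination R fun w =>
    if cs.IsLeftDescent w i then
      p • Finsupp.single (cs.simple i * w) 1 + (p - 1) • Finsupp.single w 1
    else Finsupp.single (cs.simple i * w) 1

open Classical in
/-- Right multiplication by `T_s`, as an operator on the free module on `W`. -/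
noncomputable def heckeRight (i : B) : (W →₀ R) →ₗ[R] (W →₀ R) :=
  Finsupp.linearCombination R fun w =>
    if cs.IsRightDescent w i then
      p • Finsupp.single (w * cs.simple i) 1 + (p - 1) • Finsupp.single w 1
    else Finsupp.single (w * cs.simple i) 1

theorem heckeLeft_of_descent {i : B} {w : W} (h : cs.IsLeftDescent w i) :
    cs.heckeLeft p i (Finsupp.single w 1) =
      p • Finsupp.single (cs.simple i * w) 1 + (p - 1) • Finsupp.single w 1 := by
  rw [heckeLeft, Finsupp.linearCombination_single, one_smul, if_pos h]

theorem heckeLeft_of_not_descent {i : B} {w : W} (h : ¬ cs.IsLeftDescent w i) :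
    cs.heckeLeft p i (Finsupp.single w 1) = Finsupp.single (cs.simple i * w) 1 := by
  rw [heckeLeft, Finsupp.linearCombination_single, one_smul, if_neg h]

theorem heckeRight_of_descent {i : B} {w : W} (h : cs.IsRightDescent w i) :
    cs.heckeRight p i (Finsupp.single w 1) =
      p • Finsupp.single (w * cs.simple i) 1 + (p - 1) • Finsupp.single w 1 := by
  rw [heckeRight, Finsupp.linearCombination_single, one_smul, if_pos h]

theorem heckeRight_of_not_descent {i : B} {w : W} (h : ¬ cs.IsRightDescent w i) :
    cs.heckeRight p i (Finsupp.single w 1) = Finsupp.single (w * cs.simple i) 1 := by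
  rw [heckeRight, Finsupp.linearCombination_single, one_smul, if_neg h]

theorem heckeLeft_heckeRight_comm (i j : B) (x : W →₀ R) :
    cs.heckeLeft p i (cs.heckeRight p j x) = cs.heckeRight p j (cs.heckeLeft p i x) := by
  suffices h : cs.heckeLeft p i ∘ₗ cs.heckeRight p j = cs.heckeRight p j ∘ₗ cs.heckeLeft p i from
    LinearMap.congr_fun h x
  refine Finsupp.lhom_ext' fun w => LinearMap.ext_ring ?_
  simp only [LinearMap.comp_apply, Finsupp.lsingle_apply]
  have l1 := cs.length_simple_mul w i
  have l2 := cs.length_mul_simple w j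
  have l3 := cs.length_mul_simple (cs.simple i * w) j
  have l4 := cs.length_simple_mul (w * cs.simple j) i
  rw [← mul_assoc] at l4
  by_cases a : cs.IsLeftDescent w i <;> by_cases b : cs.IsRightDescent w j
  · by_cases c : cs.IsRightDescent (cs.simple i * w) j
    · have d : cs.IsLeftDescent (w * cs.simple j) i := by
        unfold IsLeftDescent IsRightDescent at *; rw [← mul_assoc]; omega
      rw [heckeRight_of_descent _ _ b, heckeLeft_of_descent _ _ a]
      simp only [map_add, map_smul]
      rw [heckeRight_of_descent _ _ b, heckeLeft_of_descent _ _ a, heckeRight_of_descent _ _ c,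
        heckeLeft_of_descent _ _ d, ← mul_assoc]
      module
    · have d : ¬ cs.IsLeftDescent (w * cs.simple j) i := by
        unfold IsLeftDescent IsRightDescent at *; rw [← mul_assoc]; omega
      have e : w = cs.simple i * w * cs.simple j := by
        have := cs.simple_mul_eq_mul_simple (w := cs.simple i * w) (i := i) (j := j)
          (by rwa [← isLeftDescent_iff_not_isLeftDescent_mul]) c
          (by rwa [simple_mul_simple_cancel_left])
        rwa [simple_mul_simple_cancel_left] at this
      have e' : w * cs.simple j = cs.simple i * w := by
        conv_lhs => rw [e]
        simp
      rw [heckeRight_of_descent _ _ b, heckeLeft_of_descent _ _ a]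
      simp only [map_add, map_smul]
      rw [heckeRight_of_descent _ _ b, heckeLeft_of_descent _ _ a,
        heckeRight_of_not_descent _ _ c, heckeLeft_of_not_descent _ _ d, ← mul_assoc, e']
  · have c : ¬ cs.IsRightDescent (cs.simple i * w) j := by
      unfold IsLeftDescent IsRightDescent at *; omega
    have d : cs.IsLeftDescent (w * cs.simple j) i := by
      unfold IsLeftDescent IsRightDescent at *; rw [← mul_assoc]; omega
    rw [heckeRight_of_not_descent _ _ b, heckeLeft_of_descent _ _ a, heckeLeft_of_descent _ _ d]
    simp only [map_add, map_smul]
    rw [heckeRight_of_not_descent _ _ b, heckeRight_of_not_descent _ _ c, ← mul_assoc]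
  · have c : cs.IsRightDescent (cs.simple i * w) j := by
      unfold IsLeftDescent IsRightDescent at *; omega
    have d : ¬ cs.IsLeftDescent (w * cs.simple j) i := by
      unfold IsLeftDescent IsRightDescent at *; rw [← mul_assoc]; omega
    rw [heckeRight_of_descent _ _ b, heckeLeft_of_not_descent _ _ a, heckeRight_of_descent _ _ c]
    simp only [map_add, map_smul]
    rw [heckeLeft_of_not_descent _ _ a, heckeLeft_of_not_descent _ _ d, ← mul_assoc]
  · by_cases c : cs.IsRightDescent (cs.simple i * w) j
    · have d : cs.IsLeftDescent (w * cs.simple j) i := by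
        unfold IsLeftDescent IsRightDescent at *; rw [← mul_assoc]; omega
      have e := cs.simple_mul_eq_mul_simple a b c
      rw [heckeRight_of_not_descent _ _ b, heckeLeft_of_not_descent _ _ a,
        heckeRight_of_descent _ _ c, heckeLeft_of_descent _ _ d, ← mul_assoc, e]
    · have d : ¬ cs.IsLeftDescent (w * cs.simple j) i := by
        unfold IsLeftDescent IsRightDescent at *; rw [← mul_assoc]; omega
      rw [heckeRight_of_not_descent _ _ b, heckeLeft_of_not_descent _ _ a,
        heckeRight_of_not_descent _ _ c, heckeLeft_of_not_descent _ _ d, ← mul_assoc]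

/-- The algebra of operators generated by the left multiplications by the `T_s`. -/
noncomputable def heckeOperators : Subalgebra R (Module.End R (W →₀ R)) :=
  Algebra.adjoin R (Set.range (cs.heckeLeft p))

theorem heckeOperators_comm {φ : Module.End R (W →₀ R)} (hφ : φ ∈ cs.heckeOperators p) (j : B)
    (x : W →₀ R) : φ (cs.heckeRight p j x) = cs.heckeRight p j (φ x) := by
  induction hφ using Algebra.adjoin_induction generalizing x with
  | mem φ h =>
    obtain ⟨i, rfl⟩ := h
    exact cs.heckeLeft_heckeRight_comm p i j x
  | algebraMap r => simp [Module.algebraMap_end_apply]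
  | add φ ψ _ _ h1 h2 => simp [h1, h2]
  | mul φ ψ _ _ h1 h2 => simp [h1, h2]

/-- Evaluation of an operator at the basis vector indexed by `1`. -/
noncomputable def heckeEval : cs.heckeOperators p →ₗ[R] (W →₀ R) :=
  (LinearMap.applyₗ (Finsupp.single (1 : W) (1 : R))) ∘ₗ (cs.heckeOperators p).val.toLinearMap

theorem heckeEval_apply (φ : cs.heckeOperators p) :
    cs.heckeEval p φ = (φ : Module.End R (W →₀ R)) (Finsupp.single 1 1) := rfl

theorem heckeEval_injective : Function.Injective (cs.heckeEval p) := by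
  rintro ⟨φ, hφ⟩ ⟨ψ, hψ⟩ h0
  rw [heckeEval_apply, heckeEval_apply] at h0
  refine Subtype.ext ?_
  refine Finsupp.lhom_ext' fun w => LinearMap.ext_ring ?_
  change φ (Finsupp.single w 1) = ψ (Finsupp.single w 1)
  induction hn : cs.length w generalizing w with
  | zero => rw [length_eq_zero_iff] at hn; rw [hn]; exact h0
  | succ n ih =>
    obtain ⟨j, hj⟩ := cs.exists_rightDescent_of_ne_one (w := w)
      (fun h => by rw [h, length_one] at hn; omega)
    have hl := cs.isRightDescent_iff.mp hj
    have hj' : ¬ cs.IsRightDescent (w * cs.simple j) j := by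
      unfold IsRightDescent; rw [simple_mul_simple_cancel_right]; omega
    have := cs.heckeRight_of_not_descent p hj'
    rw [simple_mul_simple_cancel_right] at this
    rw [← this, cs.heckeOperators_comm p hφ, cs.heckeOperators_comm p hψ, ih _ (by omega)]

theorem heckeEval_surjective : Function.Surjective (cs.heckeEval p) := by
  rw [← LinearMap.range_eq_top, eq_top_iff, ← (Finsupp.basisSingleOne (R := R) (ι := W)).span_eq,
    Submodule.span_le]
  rintro _ ⟨w, rfl⟩
  rw [Finsupp.coe_basisSingleOne]
  induction hn : cs.length w generalizing w with
  | zero =>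
    rw [length_eq_zero_iff] at hn; rw [hn]
    exact ⟨1, rfl⟩
  | succ n ih =>
    obtain ⟨i, hi⟩ := cs.exists_leftDescent_of_ne_one (w := w)
      (fun h => by rw [h, length_one] at hn; omega)
    have hl := cs.isLeftDescent_iff.mp hi
    have hi' : ¬ cs.IsLeftDescent (cs.simple i * w) i := by
      unfold IsLeftDescent; rw [simple_mul_simple_cancel_left]; omega
    have h1 := cs.heckeLeft_of_not_descent p hi'
    rw [simple_mul_simple_cancel_left] at h1
    obtain ⟨φ, hφ⟩ := ih (cs.simple i * w) (by omega)
    refine ⟨⟨cs.heckeLeft p i, Algebra.subset_adjoin ⟨i, rfl⟩⟩ * φ, ?_⟩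
    rw [heckeEval_apply] at hφ ⊢
    change cs.heckeLeft p i ((φ : Module.End R (W →₀ R)) _) = _
    rw [hφ, h1]

/-- Operators are determined by their value at the basis vector indexed by `1`. -/
noncomputable def heckeEquiv : cs.heckeOperators p ≃ₗ[R] (W →₀ R) :=
  LinearEquiv.ofBijective (cs.heckeEval p)
    ⟨cs.heckeEval_injective p, cs.heckeEval_surjective p⟩

end CoxeterSystem

/-- The Hecke algebra of a Coxeter system with parameter `p`: the free module with basis
`(T_w)_{w ∈ W}`. Its multiplication is given below. -/
def HeckeAlgebra (_cs : CoxeterSystem M W) {R : Type*} [CommRing R] (_p : R) : Type _ := W →₀ R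

namespace HeckeAlgebra

variable {cs p}

noncomputable instance : AddCommGroup (HeckeAlgebra cs p) := inferInstanceAs (AddCommGroup (W →₀ R))

noncomputable instance : Module R (HeckeAlgebra cs p) := inferInstanceAs (Module R (W →₀ R))

/-- An element of the Hecke algebra is identified with the operator of left multiplication by it. -/
noncomputable def operatorEquiv : HeckeAlgebra cs p ≃ₗ[R] cs.heckeOperators p :=
  (cs.heckeEquiv p).symm

noncomputable instance : Mul (HeckeAlgebra cs p) :=
  ⟨fun x y => operatorEquiv.symm (operatorEquiv x * operatorEquiv y)⟩

noncomputable instance : One (HeckeAlgebra cs p) := ⟨operatorEquiv.symm 1⟩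

theorem operatorEquiv_mul (x y : HeckeAlgebra cs p) :
    operatorEquiv (x * y) = operatorEquiv x * operatorEquiv y :=
  operatorEquiv.apply_symm_apply _

theorem operatorEquiv_one : operatorEquiv (1 : HeckeAlgebra cs p) = 1 :=
  operatorEquiv.apply_symm_apply _

noncomputable instance : Ring (HeckeAlgebra cs p) :=
  { (inferInstance : AddCommGroup (HeckeAlgebra cs p)) with
    mul := (· * ·)
    one := 1
    mul_assoc := fun x y z => operatorEquiv.injective (by
      simp only [operatorEquiv_mul, mul_assoc])
    one_mul := fun x => operatorEquiv.injective (by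
      rw [operatorEquiv_mul, operatorEquiv_one, one_mul])
    mul_one := fun x => operatorEquiv.injective (by
      rw [operatorEquiv_mul, operatorEquiv_one, mul_one])
    left_distrib := fun x y z => operatorEquiv.injective (by
      simp only [operatorEquiv_mul, map_add, mul_add])
    right_distrib := fun x y z => operatorEquiv.injective (by
      simp only [operatorEquiv_mul, map_add, add_mul])
    zero_mul := fun x => operatorEquiv.injective (by
      simp only [operatorEquiv_mul, map_zero, zero_mul])
    mul_zero := fun x => operatorEquiv.injective (by
      simp only [operatorEquiv_mul, map_zero, mul_zero]) }

noncomputable instance : Algebra R (HeckeAlgebra cs p) :=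
  Algebra.ofModule
    (fun r x y => operatorEquiv.injective (by
      simp only [operatorEquiv_mul, map_smul, smul_mul_assoc]))
    (fun r x y => operatorEquiv.injective (by
      simp only [operatorEquiv_mul, map_smul, mul_smul_comm]))

variable (cs p) in
/-- The standard basis `(T_w)_{w ∈ W}`. -/
noncomputable def T : Module.Basis W R (HeckeAlgebra cs p) := ⟨LinearEquiv.refl R (W →₀ R)⟩

theorem T_eq_single (w : W) : T cs p w = (Finsupp.single w 1 : W →₀ R) := rfl

theorem operatorEquiv_T_simple (i : B) :
    (operatorEquiv (T cs p (cs.simple i)) : Module.End R (W →₀ R)) = cs.heckeLeft p i := by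
  have h : operatorEquiv (T cs p (cs.simple i)) =
      ⟨cs.heckeLeft p i, Algebra.subset_adjoin ⟨i, rfl⟩⟩ := by
    refine (LinearEquiv.eq_symm_apply _).mp ?_
    change _ = cs.heckeLeft p i (Finsupp.single 1 1)
    rw [cs.heckeLeft_of_not_descent p (cs.not_isLeftDescent_one i), mul_one]
    rfl
  rw [h]

theorem T_simple_mul_eq (i : B) (x : HeckeAlgebra cs p) :
    T cs p (cs.simple i) * x = cs.heckeLeft p i x := by
  change (operatorEquiv (T cs p (cs.simple i)) : Module.End R (W →₀ R))
    ((operatorEquiv x : Module.End R (W →₀ R)) (Finsupp.single 1 1)) = _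
  rw [operatorEquiv_T_simple]
  congr 1
  exact operatorEquiv.symm_apply_apply x

theorem T_one : T cs p 1 = 1 := rfl

/-- The multiplication rule `T_s T_w = T_{sw}` if `sw > w`. -/
theorem T_simple_mul_of_not_descent {i : B} {w : W} (h : ¬ cs.IsLeftDescent w i) :
    T cs p (cs.simple i) * T cs p w = T cs p (cs.simple i * w) := by
  rw [T_simple_mul_eq]
  exact cs.heckeLeft_of_not_descent p h

/-- The multiplication rule `T_s T_w = p T_{sw} + (p - 1) T_w` if `sw < w`. -/
theorem T_simple_mul_of_descent {i : B} {w : W} (h : cs.IsLeftDescent w i) :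
    T cs p (cs.simple i) * T cs p w = p • T cs p (cs.simple i * w) + (p - 1) • T cs p w := by
  rw [T_simple_mul_eq]
  exact cs.heckeLeft_of_descent p h

theorem isUnit_T (hp : IsUnit p) (w : W) : IsUnit (T cs p w) := by
  induction hn : cs.length w generalizing w with
  | zero =>
    rw [cs.length_eq_zero_iff] at hn
    rw [hn, T_one]; exact isUnit_one
  | succ n ih =>
    obtain ⟨i, hi⟩ := cs.exists_leftDescent_of_ne_one (w := w)
      (fun h => by rw [h, cs.length_one] at hn; omega)
    have hl := cs.isLeftDescent_iff.mp hi
    have hi' : ¬ cs.IsLeftDescent (cs.simple i * w) i := by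
      unfold CoxeterSystem.IsLeftDescent; rw [cs.simple_mul_simple_cancel_left]; omega
    have h1 := T_simple_mul_of_not_descent (p := p) hi'
    rw [cs.simple_mul_simple_cancel_left] at h1
    rw [← h1]
    refine IsUnit.mul ?_ (ih _ (by omega))
    have hs : cs.IsLeftDescent (cs.simple i) i := by
      simp [CoxeterSystem.IsLeftDescent]
    have h2 := T_simple_mul_of_descent (p := p) hs
    rw [cs.simple_mul_simple_self, T_one] at h2
    obtain ⟨u, rfl⟩ := hp
    have hc : T cs (u : R) (cs.simple i) *
        ((↑u⁻¹ : R) • (T cs (u : R) (cs.simple i) - ((u : R) - 1) • 1)) = 1 := by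
      rw [mul_smul_comm, mul_sub, h2, mul_smul_comm, mul_one, add_sub_cancel_right, smul_smul,
        Units.inv_mul, one_smul]
    have hc' : ((↑u⁻¹ : R) • (T cs (u : R) (cs.simple i) - ((u : R) - 1) • 1)) *
        T cs (u : R) (cs.simple i) = 1 := by
      rw [smul_mul_assoc, sub_mul, h2, smul_mul_assoc, one_mul, add_sub_cancel_right, smul_smul,
        Units.inv_mul, one_smul]
    exact ⟨⟨_, _, hc, hc'⟩, rfl⟩

end HeckeAlgebra

end HeckeAlgebra

section KazhdanLusztig

/-- The ring `𝒜 = ℤ[v, v⁻¹]`; the Laurent monomial `v ^ n` is `LaurentPolynomial.T n`. -/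
abbrev LaurentRing : Type := LaurentPolynomial ℤ

/-- The parameter `q = v ^ 2`. -/
noncomputable def qParam : LaurentRing := LaurentPolynomial.T 2

theorem isUnit_qParam : IsUnit qParam := LaurentPolynomial.isUnit_T 2

variable {B W : Type*} [Group W] {M : CoxeterMatrix B}

/-- The strict Bruhat order: `y < w` if `w` is reached from `y` by a nonempty chain of
length-increasing multiplications by reflections. -/
def CoxeterSystem.BruhatLT (cs : CoxeterSystem M W) (y w : W) : Prop :=
  Relation.TransGen
    (fun u u' => ∃ t, cs.IsReflection t ∧ u' = u * t ∧ cs.length u < cs.length u') y w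

/-- The bar operator of a Hecke algebra over `ℤ[v, v⁻¹]`, given by `v ^ n ↦ v ^ (-n)` and
`T_w ↦ (T_{w⁻¹})⁻¹`. -/
noncomputable def HeckeAlgebra.bar {cs : CoxeterSystem M W} {p : LaurentRing} :
    HeckeAlgebra cs p →+ HeckeAlgebra cs p :=
  (Finsupp.liftAddHom fun w : W =>
    ((smulAddHom LaurentRing (HeckeAlgebra cs p)).flip (Ring.inverse (T cs p w⁻¹))).comp
      (LaurentPolynomial.invert (R := ℤ)).toRingEquiv.toAddEquiv.toAddMonoidHom :
    (W →₀ LaurentRing) →+ HeckeAlgebra cs p)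

theorem HeckeAlgebra.bar_smul_T {cs : CoxeterSystem M W} {p : LaurentRing} (a : LaurentRing)
    (w : W) : bar (a • T cs p w) =
      LaurentPolynomial.invert a • Ring.inverse (T cs p w⁻¹) := by
  have : (a • T cs p w : HeckeAlgebra cs p) = (Finsupp.single w a : W →₀ LaurentRing) := by
    rw [T_eq_single]
    exact (Finsupp.smul_single_one w a)
  rw [this]
  exact Finsupp.liftAddHom_apply_single _ _ _

/-- The element `v ^ (-ℓ(w)) ∑_y P_y t_y` of the Hecke algebra with parameter `q`, for a (finitely
supported) family of polynomials `P_y ∈ ℤ[q]`. -/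
noncomputable def klElement (cs : CoxeterSystem M W) (w : W) (P : W →₀ Polynomial ℤ) :
    HeckeAlgebra cs qParam :=
  (LaurentPolynomial.T (-(cs.length w : ℤ)) : LaurentRing) •
    P.sum fun y f => Polynomial.aeval qParam f • HeckeAlgebra.T cs qParam y

/-- The properties characterizing the family `(P_{y,w})_{y ∈ W}` of Kazhdan-Lusztig polynomials
for fixed `w`. Condition `eq_delta` forces finite support, since lower Bruhat intervals are
finite. -/
structure IsKLFamily (cs : CoxeterSystem M W) (w : W) (P : W →₀ Polynomial ℤ) : Prop where
  bar_eq : HeckeAlgebra.bar (klElement cs w P) = klElement cs w P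
  eq_delta : ∀ y, ¬ cs.BruhatLT y w → P y = open Classical in if y = w then 1 else 0
  degree_le : ∀ y, cs.BruhatLT y w →
    ((P y).natDegree : ℚ) ≤ ((cs.length w : ℚ) - cs.length y - 1) / 2

/-- The Kazhdan-Lusztig polynomial `P_{y,w}`. -/
noncomputable def klPoly (cs : CoxeterSystem M W) (y w : W) : Polynomial ℤ :=
  (Classical.epsilon (IsKLFamily cs w) : W →₀ Polynomial ℤ) y

/-- An automorphism `w ↦ w^*` of `W` of order at most two which preserves the set of simple
generators. -/
structure CoxeterInvolution (cs : CoxeterSystem M W) where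
  star : W ≃* W
  star_star : ∀ w, star (star w) = w
  star_simple : ∀ i, ∃ j, star (cs.simple i) = cs.simple j

namespace CoxeterInvolution

variable {cs : CoxeterSystem M W} (σ : CoxeterInvolution cs)

/-- The set `𝐈_*` of twisted involutions. -/
def TwistedInvolution : Type _ := {w : W // σ.star w = w⁻¹}

theorem star_inj_simple (i : B) : σ.star (cs.simple i) * σ.star (cs.simple i) = 1 := by
  rw [← map_mul, cs.simple_mul_simple_self, map_one]

open Classical in
/-- The twisted involution `s ⋉ w`, which is `sw` if `s w s^* = w` and `s w s^*` otherwise. -/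
noncomputable def ltimes (i : B) (w : σ.TwistedInvolution) : σ.TwistedInvolution :=
  if h : cs.simple i * w.1 * σ.star (cs.simple i) = w.1 then
    ⟨cs.simple i * w.1, by
      have e : cs.simple i * w.1 = w.1 * σ.star (cs.simple i) := by
        conv_rhs => rw [← h]
        rw [mul_assoc, σ.star_inj_simple, mul_one]
      conv_rhs => rw [e]
      rw [map_mul, w.2, mul_inv_rev, inv_eq_of_mul_eq_one_left (σ.star_inj_simple i)]⟩
  else
    ⟨cs.simple i * w.1 * σ.star (cs.simple i), by
      rw [map_mul, map_mul, w.2, σ.star_star, mul_inv_rev, mul_inv_rev,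
        inv_eq_of_mul_eq_one_left (σ.star_inj_simple i), cs.inv_simple, mul_assoc]⟩

/-- The module `ℳ_{q²}`: the free module with basis `(a_w)`, `w` a twisted involution. -/
abbrev TwistedModule : Type _ := σ.TwistedInvolution →₀ LaurentRing

/-- The basis `(a_w)` of `ℳ_{q²}`. -/
noncomputable def a : Module.Basis σ.TwistedInvolution LaurentRing σ.TwistedModule :=
  Finsupp.basisSingleOne

/-- An `ℋ_{q²}`-module structure on `ℳ_{q²}` (compatible with the `ℤ[v, v⁻¹]`-module structure) is
given by an algebra homomorphism `ρ`. This is the multiplication rule for `T_s a_w` that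
characterizes the structure of interest. -/
structure IsTwistedAction
    (ρ : HeckeAlgebra cs (qParam ^ 2) →ₐ[LaurentRing] Module.End LaurentRing σ.TwistedModule) :
    Prop where
  conj_up : ∀ (i : B) (w : σ.TwistedInvolution),
    (σ.ltimes i w).1 = cs.simple i * w.1 * σ.star (cs.simple i) →
    cs.BruhatLT w.1 (σ.ltimes i w).1 →
    ρ (HeckeAlgebra.T cs _ (cs.simple i)) (σ.a w) = σ.a (σ.ltimes i w)
  left_up : ∀ (i : B) (w : σ.TwistedInvolution),
    (σ.ltimes i w).1 = cs.simple i * w.1 →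
    cs.BruhatLT w.1 (σ.ltimes i w).1 →
    ρ (HeckeAlgebra.T cs _ (cs.simple i)) (σ.a w) =
      (qParam + 1) • σ.a (σ.ltimes i w) + qParam • σ.a w
  left_down : ∀ (i : B) (w : σ.TwistedInvolution),
    (σ.ltimes i w).1 = cs.simple i * w.1 →
    cs.BruhatLT (σ.ltimes i w).1 w.1 →
    ρ (HeckeAlgebra.T cs _ (cs.simple i)) (σ.a w) =
      (qParam ^ 2 - qParam) • σ.a (σ.ltimes i w) + (qParam ^ 2 - qParam - 1) • σ.a w
  conj_down : ∀ (i : B) (w : σ.TwistedInvolution),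
    (σ.ltimes i w).1 = cs.simple i * w.1 * σ.star (cs.simple i) →
    cs.BruhatLT (σ.ltimes i w).1 w.1 →
    ρ (HeckeAlgebra.T cs _ (cs.simple i)) (σ.a w) =
      qParam ^ 2 • σ.a (σ.ltimes i w) + (qParam ^ 2 - 1) • σ.a w

open Classical in
/-- The action `(h, m) ↦ h · m` of `ℋ_{q²}` on `ℳ_{q²}`. -/
noncomputable def action :
    HeckeAlgebra cs (qParam ^ 2) →ₗ[LaurentRing] Module.End LaurentRing σ.TwistedModule :=
  if h : ∃ ρ, σ.IsTwistedAction ρ then h.choose.toLinearMap else 0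

/-- The properties characterizing the bar operator of `ℳ_{q²}`: it is a `ℤ`-linear involution which
fixes `a_1` and is compatible with the bar operator of `ℋ_{q²}`. -/
structure IsTwistedBar (β : σ.TwistedModule →+ σ.TwistedModule) : Prop where
  involutive : ∀ m, β (β m) = m
  fix_one : β (σ.a ⟨1, by simp⟩) = σ.a ⟨1, by simp⟩
  map_action : ∀ h m, β (σ.action h m) = σ.action (HeckeAlgebra.bar h) (β m)

/-- The bar operator of `ℳ_{q²}`. -/
noncomputable def bar : σ.TwistedModule →+ σ.TwistedModule := Classical.epsilon σ.IsTwistedBar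

/-- The element `v ^ (-ℓ(w)) ∑_y P_y a_y` of `ℳ_{q²}`, for a (finitely supported) family of
polynomials `P_y ∈ ℤ[q]`. -/
noncomputable def twistedKLElement (w : σ.TwistedInvolution)
    (P : σ.TwistedInvolution →₀ Polynomial ℤ) : σ.TwistedModule :=
  (LaurentPolynomial.T (-(cs.length w.1 : ℤ)) : LaurentRing) •
    P.sum fun y f => Polynomial.aeval qParam f • σ.a y

/-- The properties characterizing the family `(P^σ_{y,w})_y` of twisted Kazhdan-Lusztig
polynomials for fixed `w`. -/
structure IsTwistedKLFamily (w : σ.TwistedInvolution)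
    (P : σ.TwistedInvolution →₀ Polynomial ℤ) : Prop where
  bar_eq : σ.bar (σ.twistedKLElement w P) = σ.twistedKLElement w P
  eq_delta : ∀ y, ¬ cs.BruhatLT y.1 w.1 → P y = open Classical in if y = w then 1 else 0
  degree_le : ∀ y, cs.BruhatLT y.1 w.1 →
    ((P y).natDegree : ℚ) ≤ ((cs.length w.1 : ℚ) - cs.length y.1 - 1) / 2

/-- The twisted Kazhdan-Lusztig polynomial `P^σ_{y,w}`. -/
noncomputable def twistedKLPoly (y w : σ.TwistedInvolution) : Polynomial ℤ :=
  (Classical.epsilon (σ.IsTwistedKLFamily w) : σ.TwistedInvolution →₀ Polynomial ℤ) y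

end CoxeterInvolution

/-! ### The case of a square with the swap of factors -/

variable (cs : CoxeterSystem M W)

/-- The involution `(x, y)^* = (y, x)` of `(W', S') × (W', S')`. -/
def swapInvolution : CoxeterInvolution (cs.directProd cs) where
  star := MulEquiv.prodComm
  star_star _ := rfl
  star_simple i := by
    rw [CoxeterSystem.directProd_simple]
    rcases i with i | i
    · exact ⟨Sum.inr i, rfl⟩
    · exact ⟨Sum.inl i, rfl⟩

/-- The twisted involution `(w, w⁻¹)`. -/
def swapTwisted (w : W) : (swapInvolution cs).TwistedInvolution :=
  ⟨(w, w⁻¹), by simp [swapInvolution]⟩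

/-- The linear map `ι` with `ι(T_w) = T_{(w,1)}`. -/
noncomputable def iotaMap : HeckeAlgebra cs (qParam ^ 2) →ₗ[LaurentRing]
    HeckeAlgebra (cs.directProd cs) (qParam ^ 2) :=
  (HeckeAlgebra.T cs (qParam ^ 2)).constr LaurentRing fun w =>
    HeckeAlgebra.T (cs.directProd cs) (qParam ^ 2) (w, 1)

/-- The linear map `ι^σ` with `ι^σ(T_w) = a_{(w,w⁻¹)}`. -/
noncomputable def iotaSigma : HeckeAlgebra cs (qParam ^ 2) →ₗ[LaurentRing]
    (swapInvolution cs).TwistedModule :=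
  (HeckeAlgebra.T cs (qParam ^ 2)).constr LaurentRing fun w =>
    (swapInvolution cs).a (swapTwisted cs w)

end KazhdanLusztig

/-! For the swap of factors a twisted involution is a pair `(w, w⁻¹)`, so `ι^σ` identifies `ℳ_{q²}`
with the Hecke algebra `ℋ'` of `W'` with parameter `q²`. Under this identification the module is the
regular bimodule: `T_{(s,1)}` multiplies by `T_s` on the left and `T_{(1,s)}` multiplies by `T_s` on
the right (`isTwistedAction_swap_iff`). The two cases of the defining formulas with `s ⋉ w = sw`
never occur (`ltimes_ne_left`). Existence of the action therefore amounts to letting `T_{(x,y)}` act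
by `h ↦ T_x h T_{y⁻¹}` (`bimoduleMap_mul`). Uniqueness holds because the `T_s` generate.

The bar operator of `ℋ'` is a ring homomorphism (`HeckeAlgebra.bar_mul`), hence compatible with
multiplication on both sides (`bar_bimoduleMap`). Its transport is a bar operator on `ℳ_{q²}`, and
it is the only one because `a_1` generates the module over `ι(ℋ')`.

For (b), the substitution `v ↦ v²` takes the Hecke algebra with parameter `q` to the one with
parameter `q²` and commutes with bar (`HeckeAlgebra.mapHom_bar`). It takes `c_w` to `v^{-2ℓ(w)} ∑
P_{y,w}(q²) T_y`. Since `ℓ(w, w⁻¹) = 2ℓ(w)`, the image of this element in `ℳ_{q²}` has the shape of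
`A_{(w,w⁻¹)}`. The degree bound survives doubling, and uniqueness of twisted families finishes the
proof.

Uniqueness of both kinds of families rests on `HeckeAlgebra.eq_zero_of_bar_eq`: a bar invariant
element whose normalized coefficients have only negative powers of `v` is zero. Existence of the
ordinary polynomials (`exists_isPolynomialKL`) is the usual induction which corrects `c_s c_u` by
integer multiples of lower `c_z`. It needs the lifting property of the Bruhat order, which comes
from the strong exchange property. -/

/-! ### Generators of the Hecke algebra and homomorphisms out of it -/

namespace CoxeterSystem

variable {B W : Type*} [Group W] {M : CoxeterMatrix B} (cs : CoxeterSystem M W)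

/-- Induction on the length, by multiplication with simple generators from the left. -/
theorem left_induction {motive : W → Prop} (one : motive 1)
    (simple_mul : ∀ i w, ¬ cs.IsLeftDescent w i → motive w → motive (cs.simple i * w)) (w : W) :
    motive w := by
  induction hn : cs.length w generalizing w with
  | zero => rw [cs.length_eq_zero_iff] at hn; rwa [hn]
  | succ n ih =>
    obtain ⟨i, hi⟩ := cs.exists_leftDescent_of_ne_one (w := w)
      (fun h => by rw [h, cs.length_one] at hn; omega)
    have hl := cs.isLeftDescent_iff.mp hi
    have hi' := cs.isLeftDescent_iff_not_isLeftDescent_mul.mp hi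
    have := simple_mul i _ hi' (ih _ (by omega))
    rwa [cs.simple_mul_simple_cancel_left] at this

end CoxeterSystem

namespace HeckeAlgebra

section General

variable {B W : Type*} [Group W] {M : CoxeterMatrix B} {cs : CoxeterSystem M W}
  {R : Type*} [CommRing R] {p : R}

theorem mul_T_simple_eq (i : B) (x : HeckeAlgebra cs p) :
    x * T cs p (cs.simple i) = cs.heckeRight p i x := by
  change (operatorEquiv x : Module.End R (W →₀ R))
    ((operatorEquiv (T cs p (cs.simple i)) : Module.End R (W →₀ R)) (Finsupp.single 1 1)) = _
  rw [operatorEquiv_T_simple, cs.heckeLeft_of_not_descent p (cs.not_isLeftDescent_one i), mul_one]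
  have h := cs.heckeRight_of_not_descent p (cs.not_isRightDescent_one i)
  rw [one_mul] at h
  rw [← h, cs.heckeOperators_comm p (operatorEquiv x).2]
  congr 1
  exact operatorEquiv.symm_apply_apply x

/-- The multiplication rule `T_w T_s = T_{ws}` if `ws > w`. -/
theorem T_mul_simple_of_not_descent {i : B} {w : W} (h : ¬ cs.IsRightDescent w i) :
    T cs p w * T cs p (cs.simple i) = T cs p (w * cs.simple i) := by
  rw [mul_T_simple_eq]
  exact cs.heckeRight_of_not_descent p h

/-- The multiplication rule `T_w T_s = p T_{ws} + (p - 1) T_w` if `ws < w`. -/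
theorem T_mul_simple_of_descent {i : B} {w : W} (h : cs.IsRightDescent w i) :
    T cs p w * T cs p (cs.simple i) = p • T cs p (w * cs.simple i) + (p - 1) • T cs p w := by
  rw [mul_T_simple_eq]
  exact cs.heckeRight_of_descent p h

/-- The quadratic relation. -/
theorem T_simple_mul_self (i : B) : T cs p (cs.simple i) * T cs p (cs.simple i) =
    p • 1 + (p - 1) • T cs p (cs.simple i) := by
  have hs : cs.IsLeftDescent (cs.simple i) i := by simp [CoxeterSystem.IsLeftDescent]
  rw [T_simple_mul_of_descent hs, cs.simple_mul_simple_self, T_one]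

/-- The Hecke algebra is generated by the `T_s`. -/
theorem adjoin_T_simple :
    Algebra.adjoin R (Set.range fun i => T cs p (cs.simple i)) = ⊤ := by
  have hT : ∀ w, T cs p w ∈ Algebra.adjoin R (Set.range fun i => T cs p (cs.simple i)) := by
    intro w
    induction w using cs.left_induction with
    | one => rw [T_one]; exact one_mem _
    | simple_mul i w h ih =>
      rw [← T_simple_mul_of_not_descent h]
      exact mul_mem (Algebra.subset_adjoin ⟨i, rfl⟩) ih
  rw [eq_top_iff]
  intro x _
  rw [← (T cs p).linearCombination_repr x]
  exact Subalgebra.sum_mem _ fun w _ => Subalgebra.smul_mem _ (hT w) _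

@[elab_as_elim]
theorem induction_on {motive : HeckeAlgebra cs p → Prop} (x : HeckeAlgebra cs p)
    (algebraMap : ∀ r, motive (algebraMap R _ r))
    (simple : ∀ i, motive (T cs p (cs.simple i)))
    (add : ∀ x y, motive x → motive y → motive (x + y))
    (mul : ∀ x y, motive x → motive y → motive (x * y)) : motive x := by
  have hx : x ∈ Algebra.adjoin R (Set.range fun i => T cs p (cs.simple i)) := by
    rw [adjoin_T_simple]; exact Algebra.mem_top
  induction hx using Algebra.adjoin_induction with
  | mem x h => obtain ⟨i, rfl⟩ := h; exact simple i
  | algebraMap r => exact algebraMap r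
  | add x y _ _ h1 h2 => exact add x y h1 h2
  | mul x y _ _ h1 h2 => exact mul x y h1 h2

theorem smul_T_induction {motive : HeckeAlgebra cs p → Prop} (x : HeckeAlgebra cs p)
    (zero : motive 0) (smul_T : ∀ (r : R) (w : W), motive (r • T cs p w))
    (add : ∀ x y, motive x → motive y → motive (x + y)) : motive x := by
  classical
  rw [← (T cs p).linearCombination_repr x, Finsupp.linearCombination_apply, Finsupp.sum]
  exact Finset.sum_induction _ _ add zero fun w _ => smul_T _ w

/-- A semilinear map is multiplicative if it is compatible with the products `T_s T_w`. -/
theorem map_mul_of_simple {R' A : Type*} [CommRing R'] [Ring A] [Algebra R' A] (φ : R →+* R')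
    (f : HeckeAlgebra cs p →+ A) (hsmul : ∀ r x, f (r • x) = φ r • f x) (hone : f 1 = 1)
    (hmul : ∀ i w, f (T cs p (cs.simple i) * T cs p w) = f (T cs p (cs.simple i)) * f (T cs p w))
    (x y : HeckeAlgebra cs p) : f (x * y) = f x * f y := by
  induction x using induction_on generalizing y with
  | algebraMap r => rw [Algebra.algebraMap_eq_smul_one, smul_one_mul, hsmul, hsmul, hone,
      smul_one_mul]
  | simple i =>
    induction y using smul_T_induction with
    | zero => simp
    | smul_T r w => rw [mul_smul_comm, hsmul, hsmul, hmul, mul_smul_comm]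
    | add x y hx hy => simp [mul_add, hx, hy]
  | add a b ha hb => simp [add_mul, ha, hb]
  | mul a b ha hb => rw [mul_assoc, ha, hb, ha, mul_assoc]

/-- If `sw < w`, then `T_w = T_s T_u` with `u = sw`, so the remaining case follows from the
quadratic relation. Multiplicativity thus only has to be tested on length-increasing products and on
the squares of the generators; no braid relations enter. -/
theorem map_T_simple_mul_T {R' A : Type*} [CommRing R'] [Ring A] [Algebra R' A] {φ : R →+* R'}
    {f : HeckeAlgebra cs p →+ A} (hsmul : ∀ r x, f (r • x) = φ r • f x)
    (hup : ∀ i w, ¬ cs.IsLeftDescent w i →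
      f (T cs p (cs.simple i * w)) = f (T cs p (cs.simple i)) * f (T cs p w))
    (hquad : ∀ i, f (T cs p (cs.simple i)) * f (T cs p (cs.simple i)) =
      φ p • 1 + (φ p - 1) • f (T cs p (cs.simple i))) (i : B) (w : W) :
    f (T cs p (cs.simple i) * T cs p w) = f (T cs p (cs.simple i)) * f (T cs p w) := by
  by_cases h : cs.IsLeftDescent w i
  · obtain ⟨u, rfl⟩ : ∃ u, w = cs.simple i * u := ⟨cs.simple i * w, by simp⟩
    have hu := cs.isLeftDescent_iff_not_isLeftDescent_mul.mp h
    rw [cs.simple_mul_simple_cancel_left] at hu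
    rw [T_simple_mul_of_descent h, cs.simple_mul_simple_cancel_left, map_add, hsmul, hsmul,
      hup i u hu, ← mul_assoc, hquad, map_sub, map_one, add_mul, smul_mul_assoc, one_mul,
      smul_mul_assoc]
  · rw [T_simple_mul_of_not_descent h, hup i w h]

end General

/-! ### Base change and the bar operator -/

section BaseChange

variable {B W : Type*} [Group W] {M : CoxeterMatrix B} (cs : CoxeterSystem M W)
  {R R' : Type*} [CommRing R] [CommRing R'] (f : R →+* R') (p : R) (p' : R')

/-- The additive map between Hecke algebras over different rings with `r T_w ↦ f(r) T_w`. -/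
noncomputable def mapHom : HeckeAlgebra cs p →+ HeckeAlgebra cs p' :=
  (T cs p').repr.symm.toAddEquiv.toAddMonoidHom.comp
    ((Finsupp.mapRange.addMonoidHom f.toAddMonoidHom).comp
      (T cs p).repr.toAddEquiv.toAddMonoidHom)

theorem repr_mapHom (x : HeckeAlgebra cs p) (w : W) :
    (T cs p').repr (mapHom cs f p p' x) w = f ((T cs p).repr x w) := by
  simp [mapHom]

theorem mapHom_smul (r : R) (x : HeckeAlgebra cs p) :
    mapHom cs f p p' (r • x) = f r • mapHom cs f p p' x := by
  apply (T cs p').repr.injective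
  ext w
  simp [repr_mapHom]

theorem mapHom_T (w : W) : mapHom cs f p p' (T cs p w) = T cs p' w := by
  classical
  apply (T cs p').repr.injective
  ext y
  simp only [repr_mapHom, Module.Basis.repr_self, Finsupp.single_apply]
  split_ifs <;> simp

theorem mapHom_one : mapHom cs f p p' 1 = 1 := by
  rw [← T_one, mapHom_T, T_one]

variable {p p'} in
theorem mapHom_mul (hp : f p = p') (x y : HeckeAlgebra cs p) :
    mapHom cs f p p' (x * y) = mapHom cs f p p' x * mapHom cs f p p' y := by
  refine map_mul_of_simple f _ (mapHom_smul cs f p p') (mapHom_one cs f p p')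
    (map_T_simple_mul_T (mapHom_smul cs f p p') ?_ ?_) x y
  · intro i w h
    rw [mapHom_T, mapHom_T, mapHom_T, T_simple_mul_of_not_descent h]
  · intro i
    rw [mapHom_T, T_simple_mul_self, hp]

end BaseChange

section Bar

variable {B W : Type*} [Group W] {M : CoxeterMatrix B} {cs : CoxeterSystem M W}
  {p : LaurentRing}

theorem bar_T (w : W) : bar (T cs p w) = Ring.inverse (T cs p w⁻¹) := by
  have := bar_smul_T (cs := cs) (p := p) 1 w
  rwa [map_one, one_smul, one_smul] at this

theorem bar_smul (r : LaurentRing) (x : HeckeAlgebra cs p) :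
    bar (r • x) = LaurentPolynomial.invert r • bar x := by
  induction x using smul_T_induction with
  | zero => simp
  | smul_T s w => rw [smul_smul, bar_smul_T, bar_smul_T, map_mul, smul_smul]
  | add x y hx hy => simp [hx, hy]

theorem bar_one : bar (1 : HeckeAlgebra cs p) = 1 := by
  rw [← T_one, bar_T, inv_one, T_one, Ring.inverse_one]

/-- The condition that `v ↦ v⁻¹` inverts the parameter is all that the bar operator needs. It is
kept general so that `q` and `q²` are treated together. -/
theorem isUnit_of_mul_invert (hp : p * LaurentPolynomial.invert p = 1) : IsUnit p :=
  IsUnit.of_mul_eq_one _ hp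

theorem bar_T_simple (hp : p * LaurentPolynomial.invert p = 1) (i : B) :
    bar (T cs p (cs.simple i)) = LaurentPolynomial.invert p • T cs p (cs.simple i) +
      (LaurentPolynomial.invert p - 1) • 1 := by
  rw [bar_T, cs.inv_simple]
  have hu := isUnit_T (cs := cs) (isUnit_of_mul_invert hp) (cs.simple i)
  apply hu.mul_left_cancel
  rw [Ring.mul_inverse_cancel _ hu, mul_add, mul_smul_comm, T_simple_mul_self, mul_smul_comm,
    mul_one, smul_add, smul_smul, smul_smul, mul_comm (LaurentPolynomial.invert p) p, hp, one_smul,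
    add_assoc, ← add_smul, mul_sub, mul_comm (LaurentPolynomial.invert p) p, hp]
  simp

theorem T_simple_mul_bar (hp : p * LaurentPolynomial.invert p = 1) (i : B) :
    T cs p (cs.simple i) * bar (T cs p (cs.simple i)) = 1 := by
  rw [bar_T, cs.inv_simple]
  exact Ring.mul_inverse_cancel _ (isUnit_T (isUnit_of_mul_invert hp) _)

/-- The order is reversed twice, once by `w ↦ w⁻¹` and once by inversion in the algebra. This is why
bar is a homomorphism and not an antihomomorphism. -/
theorem bar_T_simple_mul (hp : p * LaurentPolynomial.invert p = 1) (i : B) (w : W)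
    (h : ¬ cs.IsLeftDescent w i) :
    bar (T cs p (cs.simple i * w)) = bar (T cs p (cs.simple i)) * bar (T cs p w) := by
  have h' : ¬ cs.IsRightDescent w⁻¹ i := by rwa [cs.isRightDescent_inv_iff]
  have h1 := isUnit_T (cs := cs) (isUnit_of_mul_invert hp) (cs.simple i)
  have h2 := isUnit_T (cs := cs) (isUnit_of_mul_invert hp) w⁻¹
  rw [bar_T, bar_T, bar_T, mul_inv_rev, cs.inv_simple, ← T_mul_simple_of_not_descent h']
  apply (h2.mul h1).mul_left_cancel
  rw [Ring.mul_inverse_cancel _ (h2.mul h1), mul_assoc, ← mul_assoc (T cs p (cs.simple i)),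
    Ring.mul_inverse_cancel _ h1, one_mul, Ring.mul_inverse_cancel _ h2]

theorem bar_mul (hp : p * LaurentPolynomial.invert p = 1) (x y : HeckeAlgebra cs p) :
    bar (x * y) = bar x * bar y := by
  have hs : ∀ r (x : HeckeAlgebra cs p), bar (r • x) =
      (LaurentPolynomial.invert (R := ℤ)).toRingEquiv.toRingHom r • bar x := bar_smul
  refine map_mul_of_simple _ bar hs bar_one
    (map_T_simple_mul_T hs (bar_T_simple_mul hp) ?_) x y
  intro i
  change _ = LaurentPolynomial.invert p • (1 : HeckeAlgebra cs p) +
    (LaurentPolynomial.invert p - 1) • bar (T cs p (cs.simple i))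
  -- The quadratic relation for `T_s⁻¹`, multiplied by `T_s`, is the explicit formula `bar_T_simple`
  -- for `T_s⁻¹`.
  apply (isUnit_T (cs := cs) (isUnit_of_mul_invert hp) (cs.simple i)).mul_left_cancel
  rw [← mul_assoc, T_simple_mul_bar hp, one_mul, mul_add, mul_smul_comm, mul_smul_comm,
    T_simple_mul_bar hp, mul_one, bar_T_simple hp]

theorem bar_bar (hp : p * LaurentPolynomial.invert p = 1) (x : HeckeAlgebra cs p) :
    bar (bar x) = x := by
  induction x using induction_on with
  | algebraMap r =>
    rw [Algebra.algebraMap_eq_smul_one, bar_smul, bar_smul, bar_one, bar_one,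
      LaurentPolynomial.involutive_invert r]
  | simple i =>
    -- `T_s` is a left inverse of its bar and the double bar is a right inverse, so the two agree.
    have h2 : bar (T cs p (cs.simple i)) * bar (bar (T cs p (cs.simple i))) = 1 := by
      rw [← bar_mul hp, T_simple_mul_bar hp, bar_one]
    exact (left_inv_eq_right_inv (T_simple_mul_bar hp i) h2).symm
  | add x y hx hy => simp [hx, hy]
  | mul x y hx hy => rw [bar_mul hp, bar_mul hp, hx, hy]

/-- Both composites are multiplicative and semilinear, so they are compared on the `T_s`, where
`bar_T_simple` is explicit. Used with `v ↦ v²`, this carries bar invariance of `c_w` to the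
parameter `q²`. -/
theorem mapHom_bar {p' : LaurentRing} (hp : p * LaurentPolynomial.invert p = 1)
    (f : LaurentRing →+* LaurentRing)
    (hf : ∀ r, f (LaurentPolynomial.invert r) = LaurentPolynomial.invert (f r)) (hpp : f p = p')
    (x : HeckeAlgebra cs p) : mapHom cs f p p' (bar x) = bar (mapHom cs f p p' x) := by
  have hp' : p' * LaurentPolynomial.invert p' = 1 := by rw [← hpp, ← hf, ← map_mul, hp, map_one]
  induction x using induction_on with
  | algebraMap r =>
    rw [Algebra.algebraMap_eq_smul_one, bar_smul, mapHom_smul, mapHom_smul, bar_smul, bar_one, hf,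
      mapHom_one, bar_one]
  | simple i =>
    rw [bar_T_simple hp, mapHom_T, bar_T_simple hp', map_add, mapHom_smul, mapHom_smul, mapHom_one,
      mapHom_T, map_sub, map_one, hf, hpp]
  | add x y hx hy => simp [hx, hy]
  | mul x y hx hy => rw [bar_mul hp, mapHom_mul cs f hpp, hx, hy, mapHom_mul cs f hpp, bar_mul hp']

end Bar

end HeckeAlgebra

/-! ### Strong exchange and the Bruhat order -/

namespace CoxeterSystem

variable {B W : Type*} [Group W] {M : CoxeterMatrix B} (cs : CoxeterSystem M W)

theorem signedReflHom_apply (w t : W) (ε : ZMod 2) :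
    cs.signedReflHom w (t, ε) = (w * t * w⁻¹, ε + (cs.signedReflHom w (t, 0)).2) := by
  refine Prod.ext ?_ (cs.signedReflHom_snd w t ε)
  induction w using cs.left_induction with
  | one => rw [map_one]; change t = _; simp
  | simple_mul i w h ih =>
    rw [map_mul, signedReflHom_simple]
    change cs.simple i * (cs.signedReflHom w (t, ε)).1 * cs.simple i = _
    rw [ih]
    simp [mul_assoc]

/-- A reflection flips its own sign. -/
theorem IsReflection.signedReflHom_self {t : W} (ht : cs.IsReflection t) :
    (cs.signedReflHom t (t, 0)).2 = 1 := by
  obtain ⟨u, i, rfl⟩ := ht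
  have h1 : cs.signedReflHom u⁻¹ (u * cs.simple i * u⁻¹, 0) =
      (cs.simple i, (cs.signedReflHom u⁻¹ (u * cs.simple i * u⁻¹, 0)).2) := by
    rw [cs.signedReflHom_apply]
    simp [mul_assoc]
  have h2 : cs.signedReflHom u (cs.signedReflHom u⁻¹ (u * cs.simple i * u⁻¹, 0)) =
      (u * cs.simple i * u⁻¹, 0) := by
    change (cs.signedReflHom u * cs.signedReflHom u⁻¹) _ = _
    rw [← map_mul, mul_inv_cancel, map_one]
    rfl
  rw [map_mul, map_mul, signedReflHom_simple]
  change (cs.signedReflHom u (cs.signedReflStep i (cs.signedReflHom u⁻¹ _))).2 = 1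
  rw [h1] at h2 ⊢
  have h3 : ∀ ε, cs.signedReflStep i (cs.simple i, ε) = (cs.simple i, ε + 1) := by
    intro ε; simp [signedReflStep]
  -- The signs contributed by `u⁻¹` and by `u` cancel, since `u u⁻¹` acts trivially. Only the sign
  -- flip by `s` remains.
  have h4 := congrArg Prod.snd h2
  rw [signedReflHom_snd] at h4
  rw [h3, signedReflHom_snd, add_right_comm, h4, zero_add]

/-- The strong exchange property. -/
theorem mem_rightInvSeq_of_isRightInversion {ω : List B} {t : W}
    (h : cs.IsRightInversion (cs.wordProd ω) t) : t ∈ cs.rightInvSeq ω := by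
  by_contra hn
  obtain ⟨ω', hω', hw'⟩ := cs.exists_isReduced (cs.wordProd ω * t)
  have h0 := (cs.signedReflHom_wordProd ω t).2 hn
  -- Write `w` for the product of `ω`. If `t` is missing from its inversion sequence, then `w` has
  -- sign `0` at `t`, so `wt` has sign `1` and `t` is a right inversion of `wt`. Then `w = (wt)t` is
  -- shorter than `wt`, a contradiction.
  have h1 : (cs.signedReflHom (cs.wordProd ω') (t, 0)).2 = 1 := by
    rw [← hw', map_mul]
    change (cs.signedReflHom (cs.wordProd ω) (cs.signedReflHom t (t, 0))).2 = 1
    rw [cs.signedReflHom_apply t, signedReflHom_snd, IsReflection.signedReflHom_self cs h.1,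
      mul_inv_cancel_right, h0, zero_add, add_zero]
  have hmem : t ∈ cs.rightInvSeq ω' := by
    by_contra hn'
    rw [(cs.signedReflHom_wordProd ω' t).2 hn'] at h1
    exact zero_ne_one h1
  have h2 := (cs.isRightInversion_of_mem_rightInvSeq hω' hmem).2
  rw [← hw', mul_assoc, h.1.mul_self, mul_one] at h2
  exact absurd h.2 (by omega)

/-- The elementary relation generating the Bruhat order. -/
def BruhatStep (u u' : W) : Prop :=
  ∃ t, cs.IsReflection t ∧ u' = u * t ∧ cs.length u < cs.length u'

/-- The Bruhat order. -/
def BruhatLE (y w : W) : Prop := Relation.ReflTransGen cs.BruhatStep y w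

variable {cs}

theorem BruhatLT.length_lt {y w : W} (h : cs.BruhatLT y w) : cs.length y < cs.length w := by
  induction h with
  | single h => obtain ⟨_, _, _, h⟩ := h; exact h
  | tail _ h ih => obtain ⟨_, _, _, h⟩ := h; omega

theorem bruhatLE_iff {y w : W} : cs.BruhatLE y w ↔ y = w ∨ cs.BruhatLT y w := by
  rw [BruhatLE, Relation.reflTransGen_iff_eq_or_transGen, eq_comm]
  rfl

theorem BruhatLT.le {y w : W} (h : cs.BruhatLT y w) : cs.BruhatLE y w := bruhatLE_iff.mpr (.inr h)

theorem BruhatLE.length_le {y w : W} (h : cs.BruhatLE y w) : cs.length y ≤ cs.length w := by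
  rcases bruhatLE_iff.mp h with rfl | h
  · rfl
  · exact h.length_lt.le

theorem BruhatLE.lt_of_length_lt {y w : W} (h : cs.BruhatLE y w)
    (hl : cs.length y < cs.length w) : cs.BruhatLT y w := by
  rcases bruhatLE_iff.mp h with rfl | h
  · omega
  · exact h

theorem BruhatLE.trans {x y z : W} (h : cs.BruhatLE x y) (h' : cs.BruhatLE y z) :
    cs.BruhatLE x z := Relation.ReflTransGen.trans h h'

theorem BruhatStep.simple_mul {u : W} {i : B} (h : cs.length u < cs.length (cs.simple i * u)) :
    cs.BruhatStep u (cs.simple i * u) :=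
  ⟨u⁻¹ * cs.simple i * u, by simpa using (cs.isReflection_simple i).conj u⁻¹, by simp [mul_assoc],
    h⟩

theorem bruhatLT_simple_mul {u : W} {i : B} (h : cs.length u < cs.length (cs.simple i * u)) :
    cs.BruhatLT u (cs.simple i * u) := .single (BruhatStep.simple_mul h)

theorem BruhatStep.inv {u u' : W} (h : cs.BruhatStep u u') : cs.BruhatStep u⁻¹ u'⁻¹ := by
  obtain ⟨t, ht, rfl, hl⟩ := h
  refine ⟨u * t * u⁻¹, ht.conj u, ?_, by rwa [cs.length_inv, cs.length_inv]⟩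
  rw [mul_inv_rev, ht.inv]
  simp [mul_assoc]

theorem BruhatLE.inv {u u' : W} (h : cs.BruhatLE u u') : cs.BruhatLE u⁻¹ u'⁻¹ := by
  induction h with
  | refl => exact .refl
  | tail _ h ih => exact .tail ih h.inv

/-- If `sut` is not longer than `su`, strong exchange puts `t` into the inversion sequence of `s`
followed by a reduced word of `u`. Its head `u⁻¹su` gives `su = ut`; its tail would make `ut`
shorter than `u`. -/
theorem BruhatStep.simple_mul_cases {u u' : W} (h : cs.BruhatStep u u') (i : B) :
    cs.simple i * u = u' ∨ cs.BruhatStep (cs.simple i * u) (cs.simple i * u') := by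
  obtain ⟨t, ht, rfl, hl⟩ := h
  by_cases hlt : cs.length (cs.simple i * u) < cs.length (cs.simple i * (u * t))
  · exact .inr ⟨t, ht, by rw [mul_assoc], hlt⟩
  · left
    obtain ⟨ω, hω, rfl⟩ := cs.exists_isReduced u
    have hne := ht.length_mul_left_ne (cs.simple i * cs.wordProd ω)
    rw [mul_assoc] at hne
    have hmem : t ∈ cs.rightInvSeq (i :: ω) := by
      apply cs.mem_rightInvSeq_of_isRightInversion
      refine ⟨ht, ?_⟩
      rw [cs.wordProd_cons, mul_assoc]
      omega
    rw [rightInvSeq, List.mem_cons] at hmem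
    rcases hmem with rfl | hmem
    · simp [mul_assoc]
    · have := (cs.isRightInversion_of_mem_rightInvSeq hω hmem).2
      omega

theorem BruhatLE.simple_mul_cases {y w : W} (h : cs.BruhatLE y w) (i : B) :
    cs.BruhatLE (cs.simple i * y) w ∨ cs.BruhatLE (cs.simple i * y) (cs.simple i * w) := by
  induction h with
  | refl => exact .inr .refl
  | tail _ h ih =>
    rcases ih with ih | ih
    · exact .inl (.tail ih h)
    · rcases h.simple_mul_cases i with e | h
      · rw [e] at ih; exact .inl ih
      · exact .inr (.tail ih h)

/-- The lifting property of the Bruhat order. -/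
theorem BruhatLE.simple_mul {y w : W} (h : cs.BruhatLE y w) {i : B}
    (hi : ¬ cs.IsLeftDescent w i) : cs.BruhatLE (cs.simple i * y) (cs.simple i * w) := by
  rcases h.simple_mul_cases i with h | h
  · refine .tail h (BruhatStep.simple_mul ?_)
    have := cs.not_isLeftDescent_iff.mp hi
    omega
  · exact h

end CoxeterSystem

/-! ### Vanishing of bar invariant elements with negative coefficients -/

namespace LaurentPolynomial

theorem eq_zero_of_invert_eq {f : LaurentPolynomial ℤ} (h : invert f = f)
    (hneg : ∀ n, 0 ≤ n → f.coeff n = 0) : f = 0 := by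
  ext n
  rcases le_total 0 n with hn | hn
  · simp [hneg n hn]
  · rw [← h, invert_apply, hneg _ (by omega)]
    rfl

theorem coeff_mul_T (f : LaurentPolynomial ℤ) (m n : ℤ) :
    (f * T m).coeff n = f.coeff (n - m) := by
  induction f using LaurentPolynomial.induction_on' with
  | add f g hf hg => simp [add_mul, hf, hg]
  | C_mul_T k a =>
    rw [mul_T_assoc, ← single_eq_C_mul_T, ← single_eq_C_mul_T]
    simp only [AddMonoidAlgebra.coeff_single, Finsupp.single_apply]
    congr 1
    simp only [eq_iff_iff]
    omega

end LaurentPolynomial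

namespace HeckeAlgebra

open LaurentPolynomial

variable {B W : Type*} [Group W] {M : CoxeterMatrix B} {cs : CoxeterSystem M W}
  {p : LaurentRing}

open Classical in
/-- The coefficients of `T_s x`. -/
theorem repr_T_simple_mul {R : Type*} [CommRing R] {p : R} (i : B) (x : HeckeAlgebra cs p) (y : W) :
    (T cs p).repr (T cs p (cs.simple i) * x) y =
      if cs.IsLeftDescent y i then
        (T cs p).repr x (cs.simple i * y) + (p - 1) * (T cs p).repr x y
      else p * (T cs p).repr x (cs.simple i * y) := by
  induction x using smul_T_induction with
  | zero => simp
  | add a b ha hb =>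
    rw [mul_add, map_add, map_add, Finsupp.add_apply, ha, hb]
    simp only [Finsupp.add_apply]
    split_ifs <;> ring
  | smul_T r w =>
    have h1 : w = cs.simple i * y ↔ cs.simple i * w = y := by
      constructor
      · rintro rfl; simp
      · rintro rfl; simp
    have h2 : ∀ u, cs.IsLeftDescent (cs.simple i * u) i ↔ ¬ cs.IsLeftDescent u i := by
      intro u
      rw [cs.isLeftDescent_iff_not_isLeftDescent_mul, cs.simple_mul_simple_cancel_left]
    have hs : cs.simple i ≠ 1 := by
      intro e
      have := cs.length_simple i
      rw [e, cs.length_one] at this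
      exact zero_ne_one this
    rw [mul_smul_comm]
    by_cases hw : cs.IsLeftDescent w i
    · rw [T_simple_mul_of_descent hw]
      simp only [map_smul, map_add, Module.Basis.repr_self, Finsupp.smul_apply, Finsupp.add_apply,
        Finsupp.single_apply, h1, smul_eq_mul]
      by_cases e1 : cs.simple i * w = y
      · subst e1
        rw [h2, if_neg (not_not.mpr hw)]
        simp [hs, mul_comm]
      · by_cases e2 : w = y
        · subst e2; simp [hw, hs, mul_comm]
        · simp [e1, e2]
    · rw [T_simple_mul_of_not_descent hw]
      simp only [map_smul, Module.Basis.repr_self, Finsupp.smul_apply, Finsupp.single_apply, h1,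
        smul_eq_mul]
      by_cases e1 : cs.simple i * w = y
      · subst e1
        rw [h2, if_pos hw]
        simp [hs]
      · by_cases e2 : w = y
        · subst e2; simp [hw, hs]
        · simp [e1, e2]

/-- The bar operator is triangular with respect to the length. -/
theorem repr_bar_T (hp : p * invert p = 1) (w y : W) (h : cs.length w ≤ cs.length y) :
    (T cs p).repr (bar (T cs p w)) y =
      (T cs p).repr (invert p ^ cs.length w • T cs p w) y := by
  classical
  induction w using cs.left_induction generalizing y with
  | one => rw [T_one, bar_one, cs.length_one, pow_zero, one_smul]
  | simple_mul i w hw ih =>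
    have hl := cs.not_isLeftDescent_iff.mp hw
    rw [bar_T_simple_mul hp i w hw, bar_T_simple hp, add_mul, smul_mul_assoc, smul_mul_assoc,
      one_mul, map_add, map_smul, map_smul, Finsupp.add_apply, Finsupp.smul_apply,
      Finsupp.smul_apply, repr_T_simple_mul, ih y (by omega)]
    -- Since `ℓ(sy) ≥ ℓ(y) - 1 ≥ ℓ(w)`, the induction hypothesis applies at `sy` as well as at `y`.
    have h1 := cs.length_simple_mul y i
    rw [ih (cs.simple i * y) (by omega), hl]
    have e : w ≠ y := by rintro rfl; omega
    have e' : w = cs.simple i * y ↔ cs.simple i * w = y := by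
      constructor
      · rintro rfl; simp
      · rintro rfl; simp
    simp only [map_smul, Module.Basis.repr_self, Finsupp.smul_apply, Finsupp.single_apply, e, e',
      if_false, smul_eq_mul, mul_zero, add_zero, mul_ite, mul_one]
    by_cases e1 : cs.simple i * w = y
    · subst e1
      have hd : cs.IsLeftDescent (cs.simple i * w) i := by
        rw [cs.isLeftDescent_iff_not_isLeftDescent_mul, cs.simple_mul_simple_cancel_left]
        exact hw
      simp [hd, pow_succ']
    · simp [e1]

/-- A bar invariant element vanishes if all its coefficients with respect to the normalized
standard basis contain only negative powers of `v`. -/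
theorem eq_zero_of_bar_eq {k : ℤ} (hp : p = LaurentPolynomial.T (2 * k)) {x : HeckeAlgebra cs p}
    (hx : bar x = x)
    (hneg : ∀ y, ∀ n : ℤ, 0 ≤ n →
      ((T cs p).repr x y * LaurentPolynomial.T (k * cs.length y)).coeff n = 0) : x = 0 := by
  by_contra h0
  have hp1 : p * invert p = 1 := by rw [hp, invert_T, ← T_add]; simp
  have hne : ((T cs p).repr x).support.Nonempty := by
    rw [Finsupp.support_nonempty_iff]
    exact fun h => h0 ((T cs p).repr.map_eq_zero_iff.mp h)
  -- For `y` of maximal length in the support, triangularity leaves only the term of `y` in the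
  -- coefficient of `bar x` at `y`. Hence the normalized coefficient `x_y v^{kℓ(y)}` is invariant
  -- under `v ↦ v⁻¹`; having only negative exponents, it vanishes.
  obtain ⟨y, hy, hmax⟩ := Finset.exists_max_image _ cs.length hne
  have h1 : (T cs p).repr x y =
      invert ((T cs p).repr x y) * LaurentPolynomial.T (-(2 * k * cs.length y)) := by
    conv_lhs => rw [← hx, ← (T cs p).linearCombination_repr x]
    rw [Finsupp.linearCombination_apply, Finsupp.sum, map_sum, map_sum, Finsupp.finsetSum_apply,
      Finset.sum_eq_single_of_mem y hy]
    · rw [bar_smul, map_smul, Finsupp.smul_apply, repr_bar_T hp1 y y le_rfl, hp, invert_T, T_pow]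
      simp only [map_smul, Module.Basis.repr_self, Finsupp.smul_apply, Finsupp.single_eq_same,
        smul_eq_mul, mul_one]
      congr 2; ring
    · intro z hz hzy
      rw [bar_smul, map_smul, Finsupp.smul_apply, repr_bar_T hp1 z y (hmax z hz)]
      simp [Finsupp.single_eq_of_ne hzy.symm]
  have h2 := eq_zero_of_invert_eq (f := (T cs p).repr x y * LaurentPolynomial.T (k * cs.length y))
    (by
      conv_rhs => rw [h1]
      rw [map_mul, invert_T, mul_T_assoc]
      congr 2; ring) (hneg y)
  rw [IsUnit.mul_left_eq_zero (LaurentPolynomial.isUnit_T _)] at h2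
  exact (Finsupp.mem_support_iff.mp hy) h2

end HeckeAlgebra

open LaurentPolynomial in
theorem aeval_qParam_eq_sum (f : Polynomial ℤ) : Polynomial.aeval qParam f =
    ∑ i ∈ Finset.range (f.natDegree + 1), C (f.coeff i) * T (2 * i) := by
  rw [Polynomial.aeval_eq_sum_range]
  refine Finset.sum_congr rfl fun i _ => ?_
  rw [LaurentPolynomial.smul_eq_C_mul, qParam, T_pow, mul_comm (i : ℤ)]

theorem aeval_qParam_injective :
    Function.Injective (Polynomial.aeval qParam : Polynomial ℤ →ₐ[ℤ] LaurentRing) := by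
  have h : (Polynomial.aeval qParam : Polynomial ℤ →ₐ[ℤ] LaurentRing) =
      Polynomial.toLaurentAlg.comp (Polynomial.expand ℤ 2) := by
    ext
    simp [qParam]
  rw [h]
  exact Polynomial.toLaurent_injective.comp (Polynomial.expand_injective two_pos)

-- The monomial `q^n` contributes the exponent `2n + b - a`, so the hypothesis removes exactly the
-- nonnegative exponents. In the applications `a` and `b` are the lengths of `w` and `y`.
open LaurentPolynomial in
theorem coeff_aeval_qParam_mul_T {f : Polynomial ℤ} {a b : ℤ}
    (h : ∀ n : ℕ, a ≤ 2 * n + b → f.coeff n = 0) {n : ℤ} (hn : 0 ≤ n) :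
    (T (-a) * Polynomial.aeval qParam f * T b).coeff n = 0 := by
  rw [mul_assoc, T_mul, mul_T_assoc, coeff_mul_T, aeval_qParam_eq_sum,
    AddMonoidAlgebra.coeff_sum, Finsupp.finsetSum_apply]
  refine Finset.sum_eq_zero fun i _ => ?_
  rw [coeff_mul_T, C_apply]
  split_ifs with h0
  · exact h i (by omega)
  · rfl

/-- The vanishing form of the degree bound passes to sums and differences. The assumption `b < a`
makes the bound nonnegative, as the zero polynomial with `natDegree` equal to `0` requires. -/
theorem natDegree_le_half_iff {f : Polynomial ℤ} {a b : ℕ} (hab : b < a) :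
    (f.natDegree : ℚ) ≤ ((a : ℚ) - b - 1) / 2 ↔ ∀ n : ℕ, a ≤ 2 * n + b → f.coeff n = 0 := by
  rw [le_div_iff₀ two_pos, le_sub_iff_add_le, le_sub_iff_add_le]
  norm_cast
  constructor
  · intro h n hn
    exact Polynomial.coeff_eq_zero_of_natDegree_lt (by omega)
  · intro h
    by_cases hf : f = 0
    · subst hf; simp; omega
    · by_contra hlt
      exact hf (Polynomial.leadingCoeff_eq_zero.mp (h f.natDegree (by omega)))

/-! ### Existence and uniqueness of Kazhdan-Lusztig polynomials -/

section KazhdanLusztig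

variable {B W : Type*} [Group W] {M : CoxeterMatrix B} {cs : CoxeterSystem M W}

open HeckeAlgebra

theorem qParam_mul_invert : qParam * LaurentPolynomial.invert qParam = 1 := by
  rw [qParam, LaurentPolynomial.invert_T, ← LaurentPolynomial.T_add]; simp

variable (cs) in
/-- The element `v ^ (-ℓ) ∑_y x_y t_y`, where `x` is regarded as an element of the Hecke algebra
over `ℤ[q]`. -/
noncomputable def scaledElement (l : ℕ) (x : HeckeAlgebra cs (Polynomial.X : Polynomial ℤ)) :
    HeckeAlgebra cs qParam :=
  (LaurentPolynomial.T (-(l : ℤ)) : LaurentRing) •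
    mapHom cs (Polynomial.aeval qParam : Polynomial ℤ →ₐ[ℤ] LaurentRing).toRingHom
      Polynomial.X qParam x

theorem repr_klElement (w : W) (P : W →₀ Polynomial ℤ) (y : W) :
    (T cs qParam).repr (klElement cs w P) y =
      LaurentPolynomial.T (-(cs.length w : ℤ)) * Polynomial.aeval qParam (P y) := by
  classical
  rw [klElement, map_smul, Finsupp.smul_apply, Finsupp.sum, map_sum, Finsupp.finsetSum_apply]
  simp only [map_smul, Module.Basis.repr_self, Finsupp.smul_apply, Finsupp.single_apply,
    smul_eq_mul, mul_ite, mul_one, mul_zero, Finset.sum_ite_eq', Finsupp.mem_support_iff]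
  split_ifs with h
  · rfl
  · rw [not_not.mp h, map_zero, mul_zero]

/-- The construction takes place over `ℤ[q]`, where coefficients are polynomials automatically. This
translates its outcome to `ℤ[v, v⁻¹]`, where the bar operator lives. -/
theorem klElement_repr (w : W) (x : HeckeAlgebra cs (Polynomial.X : Polynomial ℤ)) :
    klElement cs w ((T cs Polynomial.X).repr x) = scaledElement cs (cs.length w) x := by
  apply (T cs qParam).repr.injective
  ext1 y
  rw [repr_klElement, scaledElement, map_smul, Finsupp.smul_apply, repr_mapHom]
  rfl

theorem scaledElement_sub (l : ℕ) (x y : HeckeAlgebra cs (Polynomial.X : Polynomial ℤ)) :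
    scaledElement cs l (x - y) = scaledElement cs l x - scaledElement cs l y := by
  rw [scaledElement, map_sub, smul_sub]; rfl

theorem scaledElement_sum {ι : Type*} (s : Finset ι) (l : ℕ)
    (x : ι → HeckeAlgebra cs (Polynomial.X : Polynomial ℤ)) :
    scaledElement cs l (∑ i ∈ s, x i) = ∑ i ∈ s, scaledElement cs l (x i) := by
  rw [scaledElement, map_sum, Finset.smul_sum]; rfl

/-- Since `v^{-l} q^k = v^{-m}`, a correction by `c q^k` changes the normalized element by an
integer multiple of the lower one, which preserves bar invariance. -/
theorem scaledElement_monomial_smul {l m k : ℕ} (h : l = m + 2 * k) (c : ℤ)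
    (x : HeckeAlgebra cs (Polynomial.X : Polynomial ℤ)) :
    scaledElement cs l (Polynomial.monomial k c • x) =
      LaurentPolynomial.C c • scaledElement cs m x := by
  rw [scaledElement, scaledElement, mapHom_smul, smul_smul, smul_smul]
  congr 1
  change _ * Polynomial.aeval qParam _ = _
  rw [Polynomial.aeval_monomial, qParam, LaurentPolynomial.T_pow, h, mul_left_comm,
    ← LaurentPolynomial.T_add]
  congr 2
  push_cast; ring

theorem scaledElement_T_simple_add_one_mul (l : ℕ) (i : B)
    (x : HeckeAlgebra cs (Polynomial.X : Polynomial ℤ)) :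
    scaledElement cs (l + 1) ((T cs _ (cs.simple i) + 1) * x) =
      ((LaurentPolynomial.T (-1) : LaurentRing) • (T cs qParam (cs.simple i) + 1)) *
        scaledElement cs l x := by
  rw [scaledElement, scaledElement, mapHom_mul cs _ (p' := qParam)
      (show Polynomial.aeval qParam Polynomial.X = _ from Polynomial.aeval_X _), map_add,
    mapHom_T, mapHom_one, smul_mul_smul_comm, ← LaurentPolynomial.T_add]
  congr 2
  push_cast; ring

/-- The bar of `T_s + 1` is `q⁻¹(T_s + 1)`, and `v · q⁻¹ = v⁻¹`. This element is `c_s`. -/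
theorem bar_simple_klElement (i : B) :
    bar ((LaurentPolynomial.T (-1) : LaurentRing) • (T cs qParam (cs.simple i) + 1)) =
      (LaurentPolynomial.T (-1) : LaurentRing) • (T cs qParam (cs.simple i) + 1) := by
  rw [bar_smul, map_add, bar_T_simple qParam_mul_invert, bar_one, LaurentPolynomial.invert_T,
    add_assoc, sub_smul, one_smul, sub_add_cancel, ← smul_add, smul_smul, qParam,
    LaurentPolynomial.invert_T, ← LaurentPolynomial.T_add]
  rfl

/-- The properties characterizing a Kazhdan-Lusztig family, in terms of an element of the Hecke
algebra over `ℤ[q]`. -/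
structure IsPolynomialKL (w : W) (x : HeckeAlgebra cs (Polynomial.X : Polynomial ℤ)) : Prop where
  bar_eq : bar (scaledElement cs (cs.length w) x) = scaledElement cs (cs.length w) x
  self : (T cs Polynomial.X).repr x w = 1
  support : ∀ y, ¬ cs.BruhatLE y w → (T cs Polynomial.X).repr x y = 0
  coeff : ∀ y, y ≠ w → ∀ n, cs.length w ≤ 2 * n + cs.length y →
    ((T cs Polynomial.X).repr x y).coeff n = 0

theorem IsPolynomialKL.coeff_of_lt {w : W} {x : HeckeAlgebra cs (Polynomial.X : Polynomial ℤ)}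
    (h : IsPolynomialKL w x) (y : W) (n : ℕ) (hn : cs.length w < 2 * n + cs.length y) :
    ((T cs Polynomial.X).repr x y).coeff n = 0 := by
  by_cases e : y = w
  · subst e
    rw [h.self, Polynomial.coeff_one, if_neg (by omega)]
  · exact h.coeff y e n hn.le

theorem isPolynomialKL_one :
    IsPolynomialKL 1 (1 : HeckeAlgebra cs (Polynomial.X : Polynomial ℤ)) where
  bar_eq := by
    rw [scaledElement, mapHom_one, cs.length_one, Nat.cast_zero, neg_zero, LaurentPolynomial.T_zero,
      one_smul, bar_one]
  self := by rw [← T_one]; simp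
  support y hy := by
    rw [← T_one, Module.Basis.repr_self, Finsupp.single_eq_of_ne]
    rintro rfl
    exact hy .refl
  coeff y hy n _ := by
    rw [← T_one, Module.Basis.repr_self, Finsupp.single_eq_of_ne hy, Polynomial.coeff_zero]

open Classical in
theorem repr_T_simple_add_one_mul (i : B) (x : HeckeAlgebra cs (Polynomial.X : Polynomial ℤ))
    (y : W) :
    (T cs Polynomial.X).repr ((T cs _ (cs.simple i) + 1) * x) y =
      if cs.IsLeftDescent y i then
        (T cs Polynomial.X).repr x (cs.simple i * y) +
          Polynomial.X * (T cs Polynomial.X).repr x y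
      else (T cs Polynomial.X).repr x y +
        Polynomial.X * (T cs Polynomial.X).repr x (cs.simple i * y) := by
  rw [add_mul, one_mul, map_add, Finsupp.add_apply, repr_T_simple_mul]
  split_ifs <;> ring

section Step

variable {w : W} {x : HeckeAlgebra cs (Polynomial.X : Polynomial ℤ)} {i : B}

theorem IsPolynomialKL.step_self (h : IsPolynomialKL w x) (hi : ¬ cs.IsLeftDescent w i) :
    (T cs Polynomial.X).repr ((T cs _ (cs.simple i) + 1) * x) (cs.simple i * w) = 1 := by
  have hl := cs.not_isLeftDescent_iff.mp hi
  have hd : cs.IsLeftDescent (cs.simple i * w) i := by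
    rw [cs.isLeftDescent_iff_not_isLeftDescent_mul, cs.simple_mul_simple_cancel_left]; exact hi
  rw [repr_T_simple_add_one_mul, if_pos hd, cs.simple_mul_simple_cancel_left, h.self,
    h.support (cs.simple i * w), mul_zero, add_zero]
  intro hle
  have := hle.length_le
  omega

/-- Only the coefficients of `x` at `y` and `sy` enter. From `y ≤ w` one gets `y ≤ sw` because `w <
sw`, and from `sy ≤ w` by the lifting property. -/
theorem IsPolynomialKL.step_support (h : IsPolynomialKL w x) (hi : ¬ cs.IsLeftDescent w i) (y : W)
    (hy : ¬ cs.BruhatLE y (cs.simple i * w)) :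
    (T cs Polynomial.X).repr ((T cs _ (cs.simple i) + 1) * x) y = 0 := by
  have hl := cs.not_isLeftDescent_iff.mp hi
  have h1 : (T cs Polynomial.X).repr x y = 0 :=
    h.support y fun hle => hy (hle.tail (CoxeterSystem.BruhatStep.simple_mul (by omega)))
  have h2 : (T cs Polynomial.X).repr x (cs.simple i * y) = 0 :=
    h.support _ fun hle => hy (by simpa using hle.simple_mul hi)
  rw [repr_T_simple_add_one_mul, h1, h2]
  simp

/-- The strict inequality is the point: compared with the bound for `sw`, only the coefficient with
`2n + ℓ(y) = ℓ(sw)` may be in excess, and this is the one that has to be corrected. -/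
theorem IsPolynomialKL.step_coeff (h : IsPolynomialKL w x) (hi : ¬ cs.IsLeftDescent w i) (y : W)
    (n : ℕ) (hn : cs.length w + 1 < 2 * n + cs.length y) :
    ((T cs Polynomial.X).repr ((T cs _ (cs.simple i) + 1) * x) y).coeff n = 0 := by
  rw [repr_T_simple_add_one_mul]
  split_ifs with hd
  · have hl := cs.isLeftDescent_iff.mp hd
    rw [Polynomial.coeff_add, h.coeff_of_lt _ n (by omega), zero_add]
    rcases n with _ | n
    · simp
    · rw [Polynomial.coeff_X_mul]
      -- The factor `X` shifts `n` by one and leaves only a non-strict inequality, so `y ≠ w` is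
      -- needed. It holds since `s` is a left descent of `y` but not of `w`.
      refine h.coeff y ?_ n (by omega)
      rintro rfl
      exact hi hd
  · have hl := cs.not_isLeftDescent_iff.mp hd
    rw [Polynomial.coeff_add, h.coeff_of_lt _ n (by omega), zero_add]
    rcases n with _ | n
    · simp
    · rw [Polynomial.coeff_X_mul]
      exact h.coeff_of_lt _ n (by omega)

end Step

/-- For `w = su > u`, the product `c_s c_u` is bar invariant and satisfies everything except the
degree bound, which it exceeds in at most one coefficient for each `z < w`. Subtracting that
coefficient times `c_z` repairs the bound at `z`. It does no harm elsewhere, so all corrections can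
be made at once. -/
theorem exists_isPolynomialKL (w : W) :
    ∃ x : HeckeAlgebra cs (Polynomial.X : Polynomial ℤ), IsPolynomialKL w x := by
  classical
  induction hn : cs.length w using Nat.strong_induction_on generalizing w with
  | _ l ih =>
    subst hn
    by_cases hw : w = 1
    · subst hw; exact ⟨1, isPolynomialKL_one⟩
    obtain ⟨i, hi⟩ := cs.exists_leftDescent_of_ne_one hw
    obtain ⟨u, rfl⟩ : ∃ u, w = cs.simple i * u := ⟨cs.simple i * w, by simp⟩
    have hi' : ¬ cs.IsLeftDescent u i := by
      have := cs.isLeftDescent_iff_not_isLeftDescent_mul.mp hi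
      rwa [cs.simple_mul_simple_cancel_left] at this
    have hl := cs.not_isLeftDescent_iff.mp hi'
    obtain ⟨x, hx⟩ := ih _ (by omega) u rfl
    -- The length condition sits inside the existential so that a total choice function `X` results;
    -- its value `0` at long `z` is never used.
    have hex : ∀ z, ∃ x : HeckeAlgebra cs (Polynomial.X : Polynomial ℤ),
        cs.length z < cs.length (cs.simple i * u) → IsPolynomialKL z x := by
      intro z
      by_cases hz : cs.length z < cs.length (cs.simple i * u)
      · obtain ⟨x, hx⟩ := ih _ hz z rfl
        exact ⟨x, fun _ => hx⟩
      · exact ⟨0, fun h => absurd h hz⟩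
    choose X hX using hex
    set Q := (T cs Polynomial.X (cs.simple i) + 1) * x with hQ
    set L := cs.length (cs.simple i * u) with hL
    set Z := ((T cs Polynomial.X).repr Q).support.erase (cs.simple i * u) with hZ
    have hZlt : ∀ z ∈ Z, cs.BruhatLT z (cs.simple i * u) := by
      intro z hz
      rw [hZ, Finset.mem_erase, Finsupp.mem_support_iff] at hz
      by_contra hlt
      refine hz.2 (hx.step_support hi' z fun hle => ?_)
      rcases CoxeterSystem.bruhatLE_iff.mp hle with h | h
      · exact hz.1 h
      · exact hlt h
    -- The test detects that `L - ℓ(z)` is even; in the odd case no coefficient can exceed the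
    -- bound.
    let μ : W → Polynomial ℤ := fun z =>
      if cs.length z + 2 * ((L - cs.length z) / 2) = L then
        Polynomial.monomial ((L - cs.length z) / 2)
          (((T cs Polynomial.X).repr Q z).coeff ((L - cs.length z) / 2))
      else 0
    have hrepr : ∀ y, (T cs Polynomial.X).repr (Q - ∑ z ∈ Z, μ z • X z) y =
        (T cs Polynomial.X).repr Q y - ∑ z ∈ Z, μ z * (T cs Polynomial.X).repr (X z) y := by
      intro y
      rw [map_sub, map_sum, Finsupp.sub_apply, Finsupp.finsetSum_apply]
      simp only [map_smul, Finsupp.smul_apply, smul_eq_mul]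
    refine ⟨Q - ∑ z ∈ Z, μ z • X z, ?_, ?_, ?_, ?_⟩
    · rw [scaledElement_sub, scaledElement_sum, map_sub, map_sum]
      congr 1
      · rw [← hL, hl, hQ, scaledElement_T_simple_add_one_mul, bar_mul qParam_mul_invert,
          bar_simple_klElement, hx.bar_eq]
      · refine Finset.sum_congr rfl fun z hz => ?_
        simp only [μ]
        split_ifs with he
        · rw [scaledElement_monomial_smul he.symm, bar_smul, LaurentPolynomial.invert_C,
            (hX z (hZlt z hz).length_lt).bar_eq]
        · rw [zero_smul, scaledElement, map_zero, smul_zero, map_zero]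
    · rw [hrepr, hx.step_self hi', Finset.sum_eq_zero, sub_zero]
      intro z hz
      have := (hZlt z hz).length_lt
      rw [(hX z this).support, mul_zero]
      intro hle
      have := hle.length_le
      omega
    · intro y hy
      rw [hrepr, hx.step_support hi' y hy, Finset.sum_eq_zero, sub_zero]
      intro z hz
      rw [(hX z (hZlt z hz).length_lt).support, mul_zero]
      exact fun hle => hy (hle.trans (hZlt z hz).le)
    · intro y hy n hn
      -- With `k = (L - ℓ(z))/2`, the shift by `q^k` turns `L ≤ 2n + ℓ(y)` into `ℓ(z) ≤ 2(n - k) +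
      -- ℓ(y)`, where the bound for `c_z` gives zero. So corrections at different elements do not
      -- interfere.
      have hterm : ∀ z ∈ Z, z ≠ y → (μ z * (T cs Polynomial.X).repr (X z) y).coeff n = 0 := by
        intro z hz hzy
        simp only [μ]
        split_ifs with he
        · rw [← Polynomial.C_mul_X_pow_eq_monomial, mul_assoc, Polynomial.coeff_C_mul,
            Polynomial.coeff_X_pow_mul']
          split_ifs with hk
          · rw [(hX z (hZlt z hz).length_lt).coeff y hzy.symm _ (by omega), mul_zero]
          · rw [mul_zero]
        · simp
      rw [hrepr, Polynomial.coeff_sub, Polynomial.finsetSum_coeff]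
      by_cases hyZ : y ∈ Z
      · have hlt := (hZlt y hyZ).length_lt
        rw [Finset.sum_eq_single_of_mem y hyZ hterm, (hX y hlt).self, mul_one]
        simp only [μ]
        by_cases hn' : L = 2 * n + cs.length y
        · have hk : (L - cs.length y) / 2 = n := by omega
          rw [hk, if_pos (by omega), Polynomial.coeff_monomial_same, sub_self]
        · rw [hx.step_coeff hi' y n (by omega)]
          split_ifs
          · rw [Polynomial.coeff_monomial, if_neg (by omega), sub_zero]
          · simp
      · rw [Finset.sum_eq_zero fun z hz => hterm z hz (by rintro rfl; exact hyZ hz), sub_zero]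
        have : (T cs Polynomial.X).repr Q y = 0 := by
          by_contra hne
          exact hyZ (Finset.mem_erase.mpr ⟨hy, Finsupp.mem_support_iff.mpr hne⟩)
        rw [this, Polynomial.coeff_zero]

theorem existsUnique_isKLFamily (w : W) : ∃! P, IsKLFamily cs w P := by
  classical
  refine existsUnique_of_exists_of_unique ?_ ?_
  · obtain ⟨x, hx⟩ := exists_isPolynomialKL (cs := cs) w
    refine ⟨(T cs Polynomial.X).repr x, ?_, ?_, ?_⟩
    · rw [klElement_repr]; exact hx.bar_eq
    · intro y hy
      split_ifs with e
      · rw [e]; exact hx.self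
      · refine hx.support y fun hle => ?_
        rcases CoxeterSystem.bruhatLE_iff.mp hle with h | h
        · exact e h
        · exact hy h
    · intro y hy
      rw [natDegree_le_half_iff hy.length_lt]
      exact hx.coeff y (by rintro rfl; exact absurd hy.length_lt (lt_irrefl _))
  · intro P P' hP hP'
    -- The difference loses its coefficient at `w`, the only one not bounded by the degree
    -- condition, so all its normalized coefficients have negative exponents only.
    have h0 : klElement cs w P - klElement cs w P' = 0 := by
      refine eq_zero_of_bar_eq (p := qParam) (k := 1) rfl (by rw [map_sub, hP.bar_eq, hP'.bar_eq]) ?_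
      intro y n hn
      rw [one_mul, map_sub, Finsupp.sub_apply, repr_klElement, repr_klElement, ← mul_sub, ← map_sub]
      refine coeff_aeval_qParam_mul_T ?_ hn
      intro m hm
      rw [Polynomial.coeff_sub]
      by_cases hy : cs.BruhatLT y w
      · rw [(natDegree_le_half_iff hy.length_lt).mp (hP.degree_le y hy) m (by omega),
          (natDegree_le_half_iff hy.length_lt).mp (hP'.degree_le y hy) m (by omega), sub_zero]
      · rw [hP.eq_delta y hy, hP'.eq_delta y hy, sub_self]
    ext1 y
    have h1 := congrArg (fun x => (T cs qParam).repr x y) (sub_eq_zero.mp h0)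
    simp only [repr_klElement] at h1
    exact aeval_qParam_injective ((LaurentPolynomial.isUnit_T _).mul_left_cancel h1)

end KazhdanLusztig

/-! ### Length and Bruhat order of a direct product -/

namespace CoxeterSystem

variable {B₁ B₂ W₁ W₂ : Type*} [Group W₁] [Group W₂] {M₁ : CoxeterMatrix B₁}
  {M₂ : CoxeterMatrix B₂} (cs₁ : CoxeterSystem M₁ W₁) (cs₂ : CoxeterSystem M₂ W₂)

theorem directProd_simple_inl (i : B₁) :
    (directProd cs₁ cs₂).simple (Sum.inl i) = (cs₁.simple i, 1) := by
  rw [directProd_simple]; rfl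

theorem directProd_simple_inr (i : B₂) :
    (directProd cs₁ cs₂).simple (Sum.inr i) = (1, cs₂.simple i) := by
  rw [directProd_simple]; rfl

theorem wordProd_map_inl (ω : List B₁) :
    (directProd cs₁ cs₂).wordProd (ω.map Sum.inl) = (cs₁.wordProd ω, 1) := by
  induction ω with
  | nil => rfl
  | cons i ω ih =>
    rw [List.map_cons, wordProd_cons, ih, wordProd_cons, directProd_simple_inl]
    simp

theorem wordProd_map_inr (ω : List B₂) :
    (directProd cs₁ cs₂).wordProd (ω.map Sum.inr) = (1, cs₂.wordProd ω) := by
  induction ω with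
  | nil => rfl
  | cons i ω ih =>
    rw [List.map_cons, wordProd_cons, ih, wordProd_cons, directProd_simple_inr]
    simp

theorem length_add_length_le (ω : List (B₁ ⊕ B₂)) :
    cs₁.length ((directProd cs₁ cs₂).wordProd ω).1 +
      cs₂.length ((directProd cs₁ cs₂).wordProd ω).2 ≤ ω.length := by
  induction ω with
  | nil => simp [wordProd_nil]
  | cons i ω ih =>
    rw [wordProd_cons, List.length_cons]
    rcases i with i | i
    · rw [directProd_simple_inl, Prod.fst_mul, Prod.snd_mul, one_mul]
      have := cs₁.length_simple_mul ((directProd cs₁ cs₂).wordProd ω).1 i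
      simp only at this ⊢
      omega
    · rw [directProd_simple_inr, Prod.fst_mul, Prod.snd_mul, one_mul]
      have := cs₂.length_simple_mul ((directProd cs₁ cs₂).wordProd ω).2 i
      simp only at this ⊢
      omega

/-- The length function of a direct product. -/
theorem length_directProd (x : W₁) (y : W₂) :
    (directProd cs₁ cs₂).length (x, y) = cs₁.length x + cs₂.length y := by
  apply le_antisymm
  · obtain ⟨ω₁, h₁, rfl⟩ := cs₁.exists_isReduced x
    obtain ⟨ω₂, h₂, rfl⟩ := cs₂.exists_isReduced y
    have h := (directProd cs₁ cs₂).length_wordProd_le (ω₁.map Sum.inl ++ ω₂.map Sum.inr)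
    rw [wordProd_append, wordProd_map_inl, wordProd_map_inr] at h
    rw [h₁.eq, h₂.eq]
    simpa using h
  · obtain ⟨ω, hω, hxy⟩ := (directProd cs₁ cs₂).exists_isReduced (x, y)
    have h := length_add_length_le cs₁ cs₂ ω
    rw [← hxy] at h
    rwa [hxy, hω.eq]

theorem isLeftDescent_inl_iff {x : W₁} {y : W₂} {i : B₁} :
    (directProd cs₁ cs₂).IsLeftDescent (x, y) (Sum.inl i) ↔ cs₁.IsLeftDescent x i := by
  simp [IsLeftDescent, directProd_simple_inl, length_directProd]

theorem isLeftDescent_inr_iff {x : W₁} {y : W₂} {i : B₂} :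
    (directProd cs₁ cs₂).IsLeftDescent (x, y) (Sum.inr i) ↔ cs₂.IsLeftDescent y i := by
  simp [IsLeftDescent, directProd_simple_inr, length_directProd]

variable {cs₁ cs₂}

theorem BruhatStep.prod_left {x x' : W₁} (h : cs₁.BruhatStep x x') (y : W₂) :
    (directProd cs₁ cs₂).BruhatStep (x, y) (x', y) := by
  obtain ⟨_, ⟨u, i, rfl⟩, rfl, hl⟩ := h
  refine ⟨_, ⟨(u, 1), Sum.inl i, rfl⟩, ?_, ?_⟩
  · simp [directProd_simple_inl]
  · rw [length_directProd, length_directProd]; omega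

theorem BruhatStep.prod_right {y y' : W₂} (h : cs₂.BruhatStep y y') (x : W₁) :
    (directProd cs₁ cs₂).BruhatStep (x, y) (x, y') := by
  obtain ⟨_, ⟨u, i, rfl⟩, rfl, hl⟩ := h
  refine ⟨_, ⟨(1, u), Sum.inr i, rfl⟩, ?_, ?_⟩
  · simp [directProd_simple_inr]
  · rw [length_directProd, length_directProd]; omega

theorem BruhatLE.prod {x x' : W₁} {y y' : W₂} (h : cs₁.BruhatLE x x') (h' : cs₂.BruhatLE y y') :
    (directProd cs₁ cs₂).BruhatLE (x, y) (x', y') :=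
  BruhatLE.trans
    (Relation.ReflTransGen.lift (r := cs₁.BruhatStep) (p := (directProd cs₁ cs₂).BruhatStep)
      (fun x => (x, y)) (fun _ _ h => h.prod_left y) _ _ h)
    (Relation.ReflTransGen.lift (r := cs₂.BruhatStep) (p := (directProd cs₁ cs₂).BruhatStep)
      (fun y => (x', y)) (fun _ _ h => h.prod_right x') _ _ h')

/-- A reflection of the product lies in one of the factors. A step in the first factor projects to a
step, and one in the second projects to an equality. -/
theorem BruhatLE.fst {a b : W₁ × W₂} (h : (directProd cs₁ cs₂).BruhatLE a b) :
    cs₁.BruhatLE a.1 b.1 := by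
  induction h with
  | refl => exact .refl
  | @tail c _ _ h ih =>
    obtain ⟨_, ⟨u, i, rfl⟩, rfl, hl⟩ := h
    obtain ⟨c1, c2⟩ := c
    obtain ⟨u1, u2⟩ := u
    rcases i with i | i
    · refine ih.tail ⟨_, ⟨u1, i, rfl⟩, ?_, ?_⟩
      · simp [directProd_simple_inl]
      · simpa [directProd_simple_inl, length_directProd] using hl
    · simpa [directProd_simple_inr] using ih

/-- Projection and products only control the weak order. Strictness is recovered from `ℓ(w, w⁻¹) =
2ℓ(w)`. -/
theorem bruhatLT_swap_iff {W B : Type*} [Group W] {M : CoxeterMatrix B} {cs : CoxeterSystem M W}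
    {y w : W} : (directProd cs cs).BruhatLT (y, y⁻¹) (w, w⁻¹) ↔ cs.BruhatLT y w := by
  constructor
  · intro h
    have hl := h.length_lt
    rw [length_directProd, length_directProd, cs.length_inv, cs.length_inv] at hl
    exact h.le.fst.lt_of_length_lt (by simp only; omega)
  · intro h
    refine (h.le.prod h.le.inv).lt_of_length_lt ?_
    have hl := h.length_lt
    rw [length_directProd, length_directProd, cs.length_inv, cs.length_inv]
    omega

end CoxeterSystem

/-! ### The module `ℳ_{q²}` as the regular bimodule -/

section KazhdanLusztig

open HeckeAlgebra

variable {B W : Type*} [Group W] {M : CoxeterMatrix B} (cs : CoxeterSystem M W)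

/-- Twisted involutions for the swap of factors are indexed by `W`. -/
def swapTwistedEquiv : W ≃ (swapInvolution cs).TwistedInvolution where
  toFun := swapTwisted cs
  invFun w := w.1.1
  left_inv _ := rfl
  right_inv w := by
    obtain ⟨⟨x, y⟩, h⟩ := w
    have h' : ((y, x) : W × W) = (x⁻¹, y⁻¹) := h
    refine Subtype.ext ?_
    change (x, x⁻¹) = (x, y)
    rw [show y = x⁻¹ from (Prod.ext_iff.mp h').1]

theorem exists_eq_swapTwisted (w : (swapInvolution cs).TwistedInvolution) :
    ∃ u, w = swapTwisted cs u := ⟨_, ((swapTwistedEquiv cs).apply_symm_apply w).symm⟩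

/-- The map `ι^σ` as a linear equivalence. -/
noncomputable def iotaSigmaEquiv : HeckeAlgebra cs (qParam ^ 2) ≃ₗ[LaurentRing]
    (swapInvolution cs).TwistedModule :=
  (T cs (qParam ^ 2)).equiv (swapInvolution cs).a (swapTwistedEquiv cs)

theorem iotaSigma_T (w : W) :
    iotaSigma cs (T cs _ w) = (swapInvolution cs).a (swapTwisted cs w) :=
  Module.Basis.constr_basis _ _ _ _

theorem iotaMap_T (w : W) : iotaMap cs (T cs _ w) = T (cs.directProd cs) _ (w, 1) :=
  Module.Basis.constr_basis _ _ _ _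

theorem iotaSigmaEquiv_toLinearMap : (iotaSigmaEquiv cs).toLinearMap = iotaSigma cs := by
  refine (T cs _).ext fun w => ?_
  rw [iotaSigma_T]
  exact Module.Basis.equiv_apply _ _ _ _

theorem iotaSigmaEquiv_apply (x : HeckeAlgebra cs (qParam ^ 2)) :
    iotaSigmaEquiv cs x = iotaSigma cs x :=
  LinearMap.congr_fun (iotaSigmaEquiv_toLinearMap cs) x

theorem iotaSigma_bijective : Function.Bijective (iotaSigma cs) := by
  rw [← iotaSigmaEquiv_toLinearMap]
  exact (iotaSigmaEquiv cs).bijective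

theorem iotaMap_injective : Function.Injective (iotaMap cs) := by
  have h : LinearIndependent LaurentRing
      fun w : W => T (cs.directProd cs) (qParam ^ 2) (w, (1 : W)) :=
    (T (cs.directProd cs) (qParam ^ 2)).linearIndependent.comp _
      fun _ _ e => (Prod.ext_iff.mp e).1
  intro x y hxy
  apply (T cs _).repr.injective
  rw [iotaMap, Module.Basis.constr_apply, Module.Basis.constr_apply] at hxy
  exact h hxy

theorem iotaMap_mul (x y : HeckeAlgebra cs (qParam ^ 2)) :
    iotaMap cs (x * y) = iotaMap cs x * iotaMap cs y := by
  have hone : iotaMap cs 1 = 1 := by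
    rw [← T_one, iotaMap_T]; rfl
  refine map_mul_of_simple (RingHom.id _) (iotaMap cs).toAddMonoidHom (iotaMap cs).map_smul hone
    (map_T_simple_mul_T (φ := RingHom.id _) (f := (iotaMap cs).toAddMonoidHom)
      (iotaMap cs).map_smul ?_ ?_) x y
  · intro i w h
    change iotaMap cs _ = iotaMap cs _ * iotaMap cs _
    rw [iotaMap_T, iotaMap_T, iotaMap_T, ← cs.directProd_simple_inl cs, T_simple_mul_of_not_descent,
      cs.directProd_simple_inl cs]
    · simp
    · rwa [cs.isLeftDescent_inl_iff cs]
  · intro i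
    change iotaMap cs _ * iotaMap cs _ = _ • 1 + _ • iotaMap cs _
    rw [iotaMap_T, ← cs.directProd_simple_inl cs, T_simple_mul_self]
    rfl

/-- The bimodule structure of the Hecke algebra, as a linear map. -/
noncomputable def bimoduleMap : HeckeAlgebra (cs.directProd cs) (qParam ^ 2) →ₗ[LaurentRing]
    Module.End LaurentRing (HeckeAlgebra cs (qParam ^ 2)) :=
  (T (cs.directProd cs) (qParam ^ 2)).constr LaurentRing fun w =>
    LinearMap.mulLeft LaurentRing (T cs (qParam ^ 2) w.1) *
      LinearMap.mulRight LaurentRing (T cs (qParam ^ 2) w.2⁻¹)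

theorem bimoduleMap_T (x y : W) (h : HeckeAlgebra cs (qParam ^ 2)) :
    bimoduleMap cs (T _ _ (x, y)) h = T cs _ x * (h * T cs _ y⁻¹) := by
  rw [bimoduleMap, Module.Basis.constr_basis]
  rfl

theorem bimoduleMap_T_inl (i : B) (h : HeckeAlgebra cs (qParam ^ 2)) :
    bimoduleMap cs (T _ _ ((cs.directProd cs).simple (Sum.inl i))) h = T cs _ (cs.simple i) * h := by
  rw [cs.directProd_simple_inl, bimoduleMap_T, inv_one, T_one, mul_one]

theorem bimoduleMap_T_inr (i : B) (h : HeckeAlgebra cs (qParam ^ 2)) :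
    bimoduleMap cs (T _ _ ((cs.directProd cs).simple (Sum.inr i))) h = h * T cs _ (cs.simple i) := by
  rw [cs.directProd_simple_inr, bimoduleMap_T, cs.inv_simple, T_one, one_mul]

theorem bimoduleMap_one : bimoduleMap cs 1 = 1 := by
  refine LinearMap.ext fun h => ?_
  rw [← T_one]
  change bimoduleMap cs (T _ _ (1, 1)) h = h
  rw [bimoduleMap_T, inv_one, T_one, mul_one, one_mul]

theorem bimoduleMap_T_simple_mul_self (i : B ⊕ B) :
    bimoduleMap cs (T _ _ ((cs.directProd cs).simple i)) *
      bimoduleMap cs (T _ _ ((cs.directProd cs).simple i)) =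
    qParam ^ 2 • 1 + (qParam ^ 2 - 1) • bimoduleMap cs (T _ _ ((cs.directProd cs).simple i)) := by
  refine LinearMap.ext fun h => ?_
  rw [Module.End.mul_apply, LinearMap.add_apply, LinearMap.smul_apply, LinearMap.smul_apply,
    Module.End.one_apply]
  rcases i with i | i
  · rw [bimoduleMap_T_inl, bimoduleMap_T_inl, ← mul_assoc, T_simple_mul_self, add_mul,
      smul_mul_assoc, one_mul, smul_mul_assoc]
  · rw [bimoduleMap_T_inr, bimoduleMap_T_inr, mul_assoc, T_simple_mul_self, mul_add,
      mul_smul_comm, mul_one, mul_smul_comm]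

/-- The inverse in `T_{y⁻¹}` turns right multiplication into a left action, and associativity makes
it commute with left multiplication. What remains are the length-additive products and the quadratic
relation in each factor. -/
theorem bimoduleMap_mul (x y : HeckeAlgebra (cs.directProd cs) (qParam ^ 2)) :
    bimoduleMap cs (x * y) = bimoduleMap cs x * bimoduleMap cs y := by
  refine map_mul_of_simple (RingHom.id _) (bimoduleMap cs).toAddMonoidHom
    (bimoduleMap cs).map_smul
    (bimoduleMap_one cs)
    (map_T_simple_mul_T (φ := RingHom.id _) (f := (bimoduleMap cs).toAddMonoidHom)
      (bimoduleMap cs).map_smul ?_ ?_) x y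
  · rintro (i | i) ⟨x, y⟩ hd
    · refine LinearMap.ext fun h => ?_
      change bimoduleMap cs _ h = bimoduleMap cs _ (bimoduleMap cs _ h)
      rw [cs.isLeftDescent_inl_iff] at hd
      rw [bimoduleMap_T_inl, bimoduleMap_T, cs.directProd_simple_inl, Prod.mk_mul_mk, one_mul,
        bimoduleMap_T, ← T_simple_mul_of_not_descent hd, mul_assoc]
    · refine LinearMap.ext fun h => ?_
      change bimoduleMap cs _ h = bimoduleMap cs _ (bimoduleMap cs _ h)
      rw [cs.isLeftDescent_inr_iff, ← cs.isRightDescent_inv_iff] at hd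
      rw [bimoduleMap_T_inr, bimoduleMap_T, cs.directProd_simple_inr, Prod.mk_mul_mk, one_mul,
        bimoduleMap_T, mul_inv_rev, cs.inv_simple, ← T_mul_simple_of_not_descent hd]
      simp only [mul_assoc]
  · exact bimoduleMap_T_simple_mul_self cs

/-- The action of the Hecke algebra of `W × W` on `ℳ_{q²}`, transported from the bimodule structure
of the Hecke algebra of `W`. -/
noncomputable def swapAction : HeckeAlgebra (cs.directProd cs) (qParam ^ 2) →ₐ[LaurentRing]
    Module.End LaurentRing (swapInvolution cs).TwistedModule :=
  ((iotaSigmaEquiv cs).conjAlgEquiv LaurentRing).toAlgHom.comp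
    (AlgHom.ofLinearMap (bimoduleMap cs) (bimoduleMap_one cs) (bimoduleMap_mul cs))

theorem swapAction_iotaSigma (h : HeckeAlgebra (cs.directProd cs) (qParam ^ 2))
    (x : HeckeAlgebra cs (qParam ^ 2)) :
    swapAction cs h (iotaSigma cs x) = iotaSigma cs (bimoduleMap cs h x) := by
  rw [← iotaSigmaEquiv_apply, ← iotaSigmaEquiv_apply]
  change iotaSigmaEquiv cs (bimoduleMap cs h ((iotaSigmaEquiv cs).symm _)) = _
  rw [LinearEquiv.symm_apply_apply]

theorem CoxeterInvolution.ltimes_of_ne {B W : Type*} [Group W] {M : CoxeterMatrix B}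
    {cs : CoxeterSystem M W} {σ : CoxeterInvolution cs} {i : B} {w : σ.TwistedInvolution}
    (h : cs.simple i * w.1 * σ.star (cs.simple i) ≠ w.1) :
    (σ.ltimes i w).1 = cs.simple i * w.1 * σ.star (cs.simple i) := by
  unfold CoxeterInvolution.ltimes
  exact congrArg _ (dif_neg h)

theorem simple_inl_mul_swapTwisted_mul (i : B) (w : W) :
    ((cs.directProd cs).simple (Sum.inl i)) * (swapTwisted cs w).1 *
      (swapInvolution cs).star ((cs.directProd cs).simple (Sum.inl i)) =
      (swapTwisted cs (cs.simple i * w)).1 := by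
  rw [cs.directProd_simple_inl]
  change ((cs.simple i, 1) : W × W) * (w, w⁻¹) * (1, cs.simple i) = (_, _)
  simp

theorem simple_inr_mul_swapTwisted_mul (i : B) (w : W) :
    ((cs.directProd cs).simple (Sum.inr i)) * (swapTwisted cs w).1 *
      (swapInvolution cs).star ((cs.directProd cs).simple (Sum.inr i)) =
      (swapTwisted cs (w * cs.simple i)).1 := by
  rw [cs.directProd_simple_inr]
  change ((1, cs.simple i) : W × W) * (w, w⁻¹) * (cs.simple i, 1) = (_, _)
  simp

theorem ltimes_inl (i : B) (w : W) : (swapInvolution cs).ltimes (Sum.inl i) (swapTwisted cs w) =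
    swapTwisted cs (cs.simple i * w) := by
  refine Subtype.ext ((CoxeterInvolution.ltimes_of_ne ?_).trans ?_)
  rotate_left
  · exact (simple_inl_mul_swapTwisted_mul cs i w)
  · rw [simple_inl_mul_swapTwisted_mul]
    intro h
    exact cs.length_simple_mul_ne w i (congrArg cs.length (Prod.ext_iff.mp h).1)

theorem ltimes_inr (i : B) (w : W) : (swapInvolution cs).ltimes (Sum.inr i) (swapTwisted cs w) =
    swapTwisted cs (w * cs.simple i) := by
  refine Subtype.ext ((CoxeterInvolution.ltimes_of_ne ?_).trans ?_)
  rotate_left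
  · exact (simple_inr_mul_swapTwisted_mul cs i w)
  · rw [simple_inr_mul_swapTwisted_mul]
    intro h
    exact cs.length_mul_simple_ne w i (congrArg cs.length (Prod.ext_iff.mp h).1)

/-- A generator changes one component only, so its product with `(w, w⁻¹)` is no longer of the form
`(u, u⁻¹)`. This makes `left_up` and `left_down` vacuous. -/
theorem ltimes_ne_left (i : B ⊕ B) (w : (swapInvolution cs).TwistedInvolution) :
    ((swapInvolution cs).ltimes i w).1 ≠ (cs.directProd cs).simple i * w.1 := by
  obtain ⟨w, rfl⟩ := exists_eq_swapTwisted cs w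
  rcases i with i | i
  · rw [ltimes_inl, cs.directProd_simple_inl]
    intro h
    refine cs.length_mul_simple_ne w⁻¹ i (congrArg cs.length ?_)
    simpa [swapTwisted] using (Prod.ext_iff.mp h).2
  · rw [ltimes_inr, cs.directProd_simple_inr]
    intro h
    refine cs.length_mul_simple_ne w i (congrArg cs.length ?_)
    simpa [swapTwisted] using (Prod.ext_iff.mp h).1

theorem bruhatLT_swapTwisted_iff {y w : W} :
    (cs.directProd cs).BruhatLT (swapTwisted cs y).1 (swapTwisted cs w).1 ↔ cs.BruhatLT y w :=
  CoxeterSystem.bruhatLT_swap_iff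

theorem bruhatLT_simple_mul_iff {w : W} {i : B} :
    cs.BruhatLT w (cs.simple i * w) ↔ ¬ cs.IsLeftDescent w i := by
  rw [cs.not_isLeftDescent_iff]
  exact ⟨fun h => by have := h.length_lt; have := cs.length_simple_mul w i; omega,
    fun h => CoxeterSystem.bruhatLT_simple_mul (by omega)⟩

theorem simple_mul_bruhatLT_iff {w : W} {i : B} :
    cs.BruhatLT (cs.simple i * w) w ↔ cs.IsLeftDescent w i := by
  have := bruhatLT_simple_mul_iff cs (w := cs.simple i * w) (i := i)
  rw [cs.simple_mul_simple_cancel_left] at this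
  rw [this, ← cs.isLeftDescent_iff_not_isLeftDescent_mul]

theorem bruhatLT_inv_iff {y w : W} : cs.BruhatLT y⁻¹ w⁻¹ ↔ cs.BruhatLT y w := by
  have h : ∀ {y w : W}, cs.BruhatLT y w → cs.BruhatLT y⁻¹ w⁻¹ := fun h =>
    h.le.inv.lt_of_length_lt (by rw [cs.length_inv, cs.length_inv]; exact h.length_lt)
  exact ⟨fun h' => by simpa using h h', h⟩

theorem bruhatLT_mul_simple_iff {w : W} {i : B} :
    cs.BruhatLT w (w * cs.simple i) ↔ ¬ cs.IsRightDescent w i := by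
  rw [← bruhatLT_inv_iff, mul_inv_rev, cs.inv_simple, bruhatLT_simple_mul_iff,
    cs.isLeftDescent_inv_iff]

theorem mul_simple_bruhatLT_iff {w : W} {i : B} :
    cs.BruhatLT (w * cs.simple i) w ↔ cs.IsRightDescent w i := by
  rw [← bruhatLT_inv_iff, mul_inv_rev, cs.inv_simple, simple_mul_bruhatLT_iff,
    cs.isLeftDescent_inv_iff]

/-- The formulas `conj_up` and `conj_down` are the multiplication rules of the Hecke algebra with
parameter `q²`: on the left for a generator of the first factor, on the right for one of the second.
-/
theorem isTwistedAction_swap_iff (ρ : HeckeAlgebra (cs.directProd cs) (qParam ^ 2) →ₐ[LaurentRing]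
    Module.End LaurentRing (swapInvolution cs).TwistedModule) :
    (swapInvolution cs).IsTwistedAction ρ ↔ ∀ (i : B) (w : W),
      ρ (T _ _ ((cs.directProd cs).simple (Sum.inl i))) (iotaSigma cs (T cs _ w)) =
        iotaSigma cs (T cs _ (cs.simple i) * T cs _ w) ∧
      ρ (T _ _ ((cs.directProd cs).simple (Sum.inr i))) (iotaSigma cs (T cs _ w)) =
        iotaSigma cs (T cs _ w * T cs _ (cs.simple i)) := by
  constructor
  · intro h i w
    constructor
    · have e := (congrArg Subtype.val (ltimes_inl cs i w)).trans
        (simple_inl_mul_swapTwisted_mul cs i w).symm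
      by_cases hd : cs.IsLeftDescent w i
      · rw [T_simple_mul_of_descent hd, map_add, map_smul, map_smul, iotaSigma_T, iotaSigma_T,
          ← ltimes_inl]
        refine h.conj_down _ _ e ?_
        rwa [ltimes_inl, bruhatLT_swapTwisted_iff, simple_mul_bruhatLT_iff]
      · rw [T_simple_mul_of_not_descent hd, iotaSigma_T, iotaSigma_T, ← ltimes_inl]
        refine h.conj_up _ _ e ?_
        rwa [ltimes_inl, bruhatLT_swapTwisted_iff, bruhatLT_simple_mul_iff]
    · have e := (congrArg Subtype.val (ltimes_inr cs i w)).trans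
        (simple_inr_mul_swapTwisted_mul cs i w).symm
      by_cases hd : cs.IsRightDescent w i
      · rw [T_mul_simple_of_descent hd, map_add, map_smul, map_smul, iotaSigma_T, iotaSigma_T,
          ← ltimes_inr]
        refine h.conj_down _ _ e ?_
        rwa [ltimes_inr, bruhatLT_swapTwisted_iff, mul_simple_bruhatLT_iff]
      · rw [T_mul_simple_of_not_descent hd, iotaSigma_T, iotaSigma_T, ← ltimes_inr]
        refine h.conj_up _ _ e ?_
        rwa [ltimes_inr, bruhatLT_swapTwisted_iff, bruhatLT_mul_simple_iff]
  · intro h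
    refine ⟨?_, fun i w e => absurd e (ltimes_ne_left cs i w),
      fun i w e => absurd e (ltimes_ne_left cs i w), ?_⟩
    · intro i w _ hlt
      obtain ⟨w, rfl⟩ := exists_eq_swapTwisted cs w
      rcases i with i | i
      · rw [ltimes_inl, bruhatLT_swapTwisted_iff, bruhatLT_simple_mul_iff] at hlt
        rw [ltimes_inl, ← iotaSigma_T, (h i w).1, T_simple_mul_of_not_descent hlt, iotaSigma_T]
      · rw [ltimes_inr, bruhatLT_swapTwisted_iff, bruhatLT_mul_simple_iff] at hlt
        rw [ltimes_inr, ← iotaSigma_T, (h i w).2, T_mul_simple_of_not_descent hlt, iotaSigma_T]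
    · intro i w _ hlt
      obtain ⟨w, rfl⟩ := exists_eq_swapTwisted cs w
      rcases i with i | i
      · rw [ltimes_inl, bruhatLT_swapTwisted_iff, simple_mul_bruhatLT_iff] at hlt
        rw [ltimes_inl, ← iotaSigma_T, (h i w).1, T_simple_mul_of_descent hlt, map_add, map_smul,
          map_smul, iotaSigma_T]
      · rw [ltimes_inr, bruhatLT_swapTwisted_iff, mul_simple_bruhatLT_iff] at hlt
        rw [ltimes_inr, ← iotaSigma_T, (h i w).2, T_mul_simple_of_descent hlt, map_add, map_smul,
          map_smul, iotaSigma_T]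

theorem isTwistedAction_swapAction : (swapInvolution cs).IsTwistedAction (swapAction cs) := by
  rw [isTwistedAction_swap_iff]
  intro i w
  rw [swapAction_iotaSigma, swapAction_iotaSigma, bimoduleMap_T_inl, bimoduleMap_T_inr]
  exact ⟨rfl, rfl⟩

theorem eq_swapAction {ρ : HeckeAlgebra (cs.directProd cs) (qParam ^ 2) →ₐ[LaurentRing]
    Module.End LaurentRing (swapInvolution cs).TwistedModule}
    (hρ : (swapInvolution cs).IsTwistedAction ρ) : ρ = swapAction cs := by
  have h1 := (isTwistedAction_swap_iff cs ρ).mp hρ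
  have h2 := (isTwistedAction_swap_iff cs _).mp (isTwistedAction_swapAction cs)
  refine AlgHom.ext_of_adjoin_eq_top adjoin_T_simple ?_
  rintro _ ⟨i, rfl⟩
  refine (swapInvolution cs).a.ext fun w => ?_
  obtain ⟨w, rfl⟩ := exists_eq_swapTwisted cs w
  simp only [← iotaSigma_T]
  rcases i with i | i
  · rw [(h1 i w).1, (h2 i w).1]
  · rw [(h1 i w).2, (h2 i w).2]

theorem existsUnique_isTwistedAction : ∃! ρ, (swapInvolution cs).IsTwistedAction ρ :=
  ⟨swapAction cs, isTwistedAction_swapAction cs, fun _ h => eq_swapAction cs h⟩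

theorem action_swap_eq : (swapInvolution cs).action = (swapAction cs).toLinearMap := by
  have h : ∃ ρ, (swapInvolution cs).IsTwistedAction ρ := ⟨_, isTwistedAction_swapAction cs⟩
  rw [CoxeterInvolution.action, dif_pos h, eq_swapAction cs h.choose_spec]

theorem action_iotaSigma (h : HeckeAlgebra (cs.directProd cs) (qParam ^ 2))
    (x : HeckeAlgebra cs (qParam ^ 2)) :
    (swapInvolution cs).action h (iotaSigma cs x) = iotaSigma cs (bimoduleMap cs h x) := by
  rw [action_swap_eq]
  exact swapAction_iotaSigma cs h x

theorem bimoduleMap_iotaMap (x y : HeckeAlgebra cs (qParam ^ 2)) :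
    bimoduleMap cs (iotaMap cs x) y = x * y := by
  induction x using smul_T_induction with
  | zero => simp
  | smul_T r w =>
    rw [map_smul, map_smul, iotaMap_T, LinearMap.smul_apply, bimoduleMap_T, inv_one, T_one, mul_one,
      smul_mul_assoc]
  | add a b ha hb => rw [map_add, map_add, LinearMap.add_apply, ha, hb, add_mul]

theorem iotaSigma_mul (x y : HeckeAlgebra cs (qParam ^ 2)) :
    iotaSigma cs (x * y) = (swapInvolution cs).action (iotaMap cs x) (iotaSigma cs y) := by
  rw [action_iotaSigma, bimoduleMap_iotaMap]

end KazhdanLusztig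

/-! ### The bar operator of `ℳ_{q²}` and the substitution `v ↦ v²` -/

section KazhdanLusztig

open HeckeAlgebra

/-- The ring endomorphism `v ↦ v ^ 2` of `ℤ[v, v⁻¹]`. -/
noncomputable def squareHom : LaurentRing →+* LaurentRing :=
  AddMonoidAlgebra.mapDomainRingHom ℤ (AddMonoidHom.mulLeft (2 : ℤ))

theorem squareHom_T (n : ℤ) :
    squareHom (LaurentPolynomial.T n) = LaurentPolynomial.T (2 * n) := by
  rw [squareHom, AddMonoidAlgebra.mapDomainRingHom_apply]
  exact AddMonoidAlgebra.mapDomain_single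

theorem squareHom_C_mul_T (r n : ℤ) :
    squareHom (LaurentPolynomial.C r * LaurentPolynomial.T n) =
      LaurentPolynomial.C r * LaurentPolynomial.T (2 * n) := by
  rw [map_mul, squareHom_T]
  congr 1
  rw [eq_intCast, map_intCast]

theorem squareHom_invert (f : LaurentRing) :
    squareHom (LaurentPolynomial.invert f) = LaurentPolynomial.invert (squareHom f) := by
  induction f using LaurentPolynomial.induction_on' with
  | add f g hf hg => simp only [map_add, hf, hg]
  | C_mul_T n a =>
    simp only [squareHom_C_mul_T, map_mul LaurentPolynomial.invert, LaurentPolynomial.invert_T,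
      LaurentPolynomial.invert_C, mul_neg]

theorem squareHom_qParam : squareHom qParam = qParam ^ 2 := by
  rw [qParam, squareHom_T, LaurentPolynomial.T_pow]; rfl

theorem squareHom_aeval (f : Polynomial ℤ) :
    squareHom (Polynomial.aeval qParam f) =
      Polynomial.aeval qParam (f.comp (Polynomial.X ^ 2)) := by
  rw [Polynomial.aeval_comp, map_pow, Polynomial.aeval_X, ← squareHom_qParam]
  exact (Polynomial.aeval_algHom_apply squareHom.toIntAlgHom qParam f).symm

theorem qParam_sq_eq : qParam ^ 2 = LaurentPolynomial.T (2 * 2) := by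
  rw [qParam, LaurentPolynomial.T_pow]; rfl

theorem qParam_sq_mul_invert : qParam ^ 2 * LaurentPolynomial.invert (qParam ^ 2) = 1 := by
  rw [map_pow, ← mul_pow, qParam_mul_invert, one_pow]

variable {B W : Type*} [Group W] {M : CoxeterMatrix B} (cs : CoxeterSystem M W)

/-- Bar is a ring homomorphism, so it respects left and right multiplication by `T_s`. The general
case follows since both sides are compatible with products in `h`. -/
theorem bar_bimoduleMap (h : HeckeAlgebra (cs.directProd cs) (qParam ^ 2))
    (x : HeckeAlgebra cs (qParam ^ 2)) :
    bar (bimoduleMap cs h x) = bimoduleMap cs (bar h) (bar x) := by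
  induction h using induction_on generalizing x with
  | algebraMap r =>
    rw [Algebra.algebraMap_eq_smul_one, bar_smul, bar_one, map_smul, map_smul, bimoduleMap_one,
      LinearMap.smul_apply, LinearMap.smul_apply, bar_smul]
    rfl
  | simple i =>
    rw [bar_T_simple qParam_sq_mul_invert, map_add, map_smul, map_smul, bimoduleMap_one,
      LinearMap.add_apply, LinearMap.smul_apply, LinearMap.smul_apply, Module.End.one_apply]
    rcases i with i | i
    · rw [bimoduleMap_T_inl, bimoduleMap_T_inl, bar_mul qParam_sq_mul_invert,
        bar_T_simple qParam_sq_mul_invert, add_mul, smul_mul_assoc, smul_mul_assoc, one_mul]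
    · rw [bimoduleMap_T_inr, bimoduleMap_T_inr, bar_mul qParam_sq_mul_invert,
        bar_T_simple qParam_sq_mul_invert, mul_add, mul_smul_comm, mul_smul_comm, mul_one]
  | add a b ha hb => rw [map_add, map_add, map_add, LinearMap.add_apply, LinearMap.add_apply,
      map_add, ha, hb]
  | mul a b ha hb => rw [bimoduleMap_mul, Module.End.mul_apply, ha, hb,
      bar_mul qParam_sq_mul_invert, bimoduleMap_mul, Module.End.mul_apply]

/-- The bar operator of `ℳ_{q²}`, transported from the Hecke algebra of `W`. -/
noncomputable def swapBar : (swapInvolution cs).TwistedModule →+ (swapInvolution cs).TwistedModule :=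
  (iotaSigma cs).toAddMonoidHom.comp
    (bar.comp (iotaSigmaEquiv cs).symm.toLinearMap.toAddMonoidHom)

theorem swapBar_iotaSigma (x : HeckeAlgebra cs (qParam ^ 2)) :
    swapBar cs (iotaSigma cs x) = iotaSigma cs (bar x) := by
  rw [← iotaSigmaEquiv_apply cs x]
  change iotaSigma cs (bar ((iotaSigmaEquiv cs).symm _)) = _
  rw [LinearEquiv.symm_apply_apply]

theorem a_one_eq : (swapInvolution cs).a ⟨1, by simp⟩ = iotaSigma cs 1 := by
  rw [← T_one, iotaSigma_T]
  congr 1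
  refine Subtype.ext ?_
  change ((1, 1) : W × W) = (1, 1⁻¹)
  rw [inv_one]

theorem isTwistedBar_swapBar : (swapInvolution cs).IsTwistedBar (swapBar cs) where
  involutive m := by
    obtain ⟨x, rfl⟩ := (iotaSigma_bijective cs).2 m
    rw [swapBar_iotaSigma, swapBar_iotaSigma, bar_bar qParam_sq_mul_invert]
  fix_one := by rw [a_one_eq, swapBar_iotaSigma, bar_one]
  map_action h m := by
    obtain ⟨x, rfl⟩ := (iotaSigma_bijective cs).2 m
    rw [action_iotaSigma, swapBar_iotaSigma, swapBar_iotaSigma, action_iotaSigma, bar_bimoduleMap]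

theorem eq_swapBar {β : (swapInvolution cs).TwistedModule →+ (swapInvolution cs).TwistedModule}
    (hβ : (swapInvolution cs).IsTwistedBar β) : β = swapBar cs := by
  -- Every element of `ℳ_{q²}` is `ι(x) · a_1`, so compatibility with the action and the value at
  -- `a_1` leave no freedom.
  have key : ∀ {β}, (swapInvolution cs).IsTwistedBar β → ∀ x, β (iotaSigma cs x) =
      (swapInvolution cs).action (bar (iotaMap cs x)) (iotaSigma cs 1) := by
    intro β hβ x
    conv_lhs => rw [← mul_one x, iotaSigma_mul]
    rw [hβ.map_action, ← a_one_eq, hβ.fix_one]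
  refine AddMonoidHom.ext fun m => ?_
  obtain ⟨x, rfl⟩ := (iotaSigma_bijective cs).2 m
  rw [key hβ, key (isTwistedBar_swapBar cs)]

theorem existsUnique_isTwistedBar : ∃! β, (swapInvolution cs).IsTwistedBar β :=
  ⟨swapBar cs, isTwistedBar_swapBar cs, fun _ h => eq_swapBar cs h⟩

theorem bar_iotaSigma (x : HeckeAlgebra cs (qParam ^ 2)) :
    (swapInvolution cs).bar (iotaSigma cs x) = iotaSigma cs (bar x) := by
  rw [CoxeterInvolution.bar, eq_swapBar cs (Classical.epsilon_spec ⟨_, isTwistedBar_swapBar cs⟩),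
    swapBar_iotaSigma]

theorem repr_iotaSigma (x : HeckeAlgebra cs (qParam ^ 2)) (y : W) :
    (swapInvolution cs).a.repr (iotaSigma cs x) (swapTwisted cs y) = (T cs _).repr x y := by
  classical
  induction x using smul_T_induction with
  | zero => simp
  | add a b ha hb => rw [map_add, map_add, Finsupp.add_apply, ha, hb, map_add, Finsupp.add_apply]
  | smul_T r w =>
    rw [map_smul, map_smul, Finsupp.smul_apply, iotaSigma_T, map_smul, Finsupp.smul_apply,
      Module.Basis.repr_self, Module.Basis.repr_self, Finsupp.single_apply, Finsupp.single_apply]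
    congr 2
    exact propext (swapTwistedEquiv cs).injective.eq_iff

theorem length_swapTwisted (w : W) :
    (cs.directProd cs).length (swapTwisted cs w).1 = 2 * cs.length w := by
  change (cs.directProd cs).length (w, w⁻¹) = _
  rw [cs.length_directProd, cs.length_inv, two_mul]

theorem repr_twistedKLElement (w : (swapInvolution cs).TwistedInvolution)
    (P : (swapInvolution cs).TwistedInvolution →₀ Polynomial ℤ)
    (y : (swapInvolution cs).TwistedInvolution) :
    (swapInvolution cs).a.repr ((swapInvolution cs).twistedKLElement w P) y =
      LaurentPolynomial.T (-((cs.directProd cs).length w.1 : ℤ)) *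
        Polynomial.aeval qParam (P y) := by
  classical
  rw [CoxeterInvolution.twistedKLElement, map_smul, Finsupp.smul_apply, Finsupp.sum, map_sum,
    Finsupp.finsetSum_apply]
  simp only [map_smul, Module.Basis.repr_self, Finsupp.smul_apply, Finsupp.single_apply,
    smul_eq_mul, mul_ite, mul_one, mul_zero, Finset.sum_ite_eq', Finsupp.mem_support_iff]
  split_ifs with h
  · rfl
  · rw [not_not.mp h, map_zero, mul_zero]

theorem isTwistedKLFamily_unique {w : (swapInvolution cs).TwistedInvolution}
    {P P' : (swapInvolution cs).TwistedInvolution →₀ Polynomial ℤ}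
    (hP : (swapInvolution cs).IsTwistedKLFamily w P)
    (hP' : (swapInvolution cs).IsTwistedKLFamily w P') : P = P' := by
  obtain ⟨x, hx⟩ := (iotaSigma_bijective cs).2
    ((swapInvolution cs).twistedKLElement w P - (swapInvolution cs).twistedKLElement w P')
  have h0 : x = 0 := by
    -- Here `q² = v^{2·2}`, so the normalizing exponent at `y` is `2ℓ(y) = ℓ(y, y⁻¹)`, the length
    -- that occurs in the twisted degree bound.
    refine eq_zero_of_bar_eq qParam_sq_eq ?_ ?_
    · apply (iotaSigma_bijective cs).1
      rw [← bar_iotaSigma, hx, map_sub, hP.bar_eq, hP'.bar_eq]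
    · intro y n hn
      rw [← repr_iotaSigma, hx, map_sub, Finsupp.sub_apply, repr_twistedKLElement,
        repr_twistedKLElement, ← mul_sub, ← map_sub]
      refine coeff_aeval_qParam_mul_T ?_ hn
      intro m hm
      rw [Polynomial.coeff_sub]
      by_cases hy : (cs.directProd cs).BruhatLT (swapTwisted cs y).1 w.1
      · have hl := length_swapTwisted cs y
        rw [(natDegree_le_half_iff hy.length_lt).mp (hP.degree_le _ hy) m (by omega),
          (natDegree_le_half_iff hy.length_lt).mp (hP'.degree_le _ hy) m (by omega), sub_zero]
      · rw [hP.eq_delta _ hy, hP'.eq_delta _ hy, sub_self]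
  rw [h0, map_zero] at hx
  ext1 y
  have h1 := congrArg (fun m => (swapInvolution cs).a.repr m y) (sub_eq_zero.mp hx.symm)
  simp only [repr_twistedKLElement] at h1
  exact aeval_qParam_injective ((LaurentPolynomial.isUnit_T _).mul_left_cancel h1)

/-- The family `(P_y(q²))_y`, indexed by twisted involutions. -/
noncomputable def swapFamily (P : W →₀ Polynomial ℤ) :
    (swapInvolution cs).TwistedInvolution →₀ Polynomial ℤ :=
  (P.mapRange (fun f => f.comp (Polynomial.X ^ 2)) Polynomial.zero_comp).equivMapDomain
    (swapTwistedEquiv cs)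

theorem swapFamily_apply (P : W →₀ Polynomial ℤ) (y : W) :
    swapFamily cs P (swapTwisted cs y) = (P y).comp (Polynomial.X ^ 2) := rfl

/-- Under `v ↦ v²` the factor `v^{-ℓ(w)}` becomes `v^{-2ℓ(w)}`, the normalization belonging to `(w,
w⁻¹)`, and `P_y(q)` becomes `P_y(q²)`. -/
theorem twistedKLElement_swapFamily (w : W) (P : W →₀ Polynomial ℤ) :
    (swapInvolution cs).twistedKLElement (swapTwisted cs w) (swapFamily cs P) =
      iotaSigma cs (mapHom cs squareHom qParam (qParam ^ 2) (klElement cs w P)) := by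
  apply (swapInvolution cs).a.repr.injective
  ext1 y
  obtain ⟨y, rfl⟩ := exists_eq_swapTwisted cs y
  rw [repr_iotaSigma, repr_mapHom, repr_twistedKLElement, repr_klElement, map_mul, squareHom_T,
    squareHom_aeval, length_swapTwisted, swapFamily_apply]
  congr 2
  push_cast; ring

theorem isTwistedKLFamily_swapFamily {w : W} {P : W →₀ Polynomial ℤ} (hP : IsKLFamily cs w P) :
    (swapInvolution cs).IsTwistedKLFamily (swapTwisted cs w) (swapFamily cs P) where
  bar_eq := by
    rw [twistedKLElement_swapFamily, bar_iotaSigma,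
      ← mapHom_bar qParam_mul_invert _ squareHom_invert squareHom_qParam, hP.bar_eq]
  eq_delta y hy := by
    classical
    obtain ⟨y, rfl⟩ := exists_eq_swapTwisted cs y
    rw [bruhatLT_swapTwisted_iff] at hy
    have e : swapTwisted cs y = swapTwisted cs w ↔ y = w :=
      (swapTwistedEquiv cs).injective.eq_iff
    rw [swapFamily_apply, hP.eq_delta y hy]
    simp only [e]
    split_ifs
    · rw [Polynomial.one_comp]
    · rw [Polynomial.zero_comp]
  degree_le y hy := by
    obtain ⟨y, rfl⟩ := exists_eq_swapTwisted cs y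
    rw [bruhatLT_swapTwisted_iff] at hy
    have h := hP.degree_le y hy
    rw [swapFamily_apply, length_swapTwisted, length_swapTwisted, Polynomial.natDegree_comp,
      Polynomial.natDegree_X_pow]
    -- The doubled bound is `2 deg P_y ≤ ℓ(w) - ℓ(y) - 1`, which is stronger by `1/2` than the
    -- required `(2ℓ(w) - 2ℓ(y) - 1)/2`.
    push_cast
    linarith

theorem existsUnique_isTwistedKLFamily (w : (swapInvolution cs).TwistedInvolution) :
    ∃! P, (swapInvolution cs).IsTwistedKLFamily w P := by
  obtain ⟨w, rfl⟩ := exists_eq_swapTwisted cs w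
  obtain ⟨P, hP, _⟩ := existsUnique_isKLFamily (cs := cs) w
  exact ⟨_, isTwistedKLFamily_swapFamily cs hP, fun _ h =>
    isTwistedKLFamily_unique cs h (isTwistedKLFamily_swapFamily cs hP)⟩

theorem twistedKLPoly_swapTwisted (y w : W) :
    (swapInvolution cs).twistedKLPoly (swapTwisted cs y) (swapTwisted cs w) =
      (klPoly cs y w).comp (Polynomial.X ^ 2) := by
  have h1 := Classical.epsilon_spec (existsUnique_isKLFamily (cs := cs) w).exists
  have h2 := Classical.epsilon_spec (existsUnique_isTwistedKLFamily cs (swapTwisted cs w)).exists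
  rw [CoxeterInvolution.twistedKLPoly,
    isTwistedKLFamily_unique cs h2 (isTwistedKLFamily_swapFamily cs h1), swapFamily_apply]
  rfl

end KazhdanLusztig

theorem mainTheorem5 {B W : Type*} [Group W] {M : CoxeterMatrix B} (cs : CoxeterSystem M W) :
    -- the module structure, the bar operator and both families of polynomials are well defined
    ((∃! ρ, (swapInvolution cs).IsTwistedAction ρ) ∧
      (∃! β, (swapInvolution cs).IsTwistedBar β) ∧
      (∀ w, ∃! P, IsKLFamily cs w P) ∧
      (∀ w, ∃! P, (swapInvolution cs).IsTwistedKLFamily w P)) ∧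
    -- part (a)
    (Function.Injective (iotaMap cs) ∧
      Function.Bijective (iotaSigma cs) ∧
      (∀ x y, iotaMap cs (x * y) = iotaMap cs x * iotaMap cs y) ∧
      (∀ x y, iotaSigma cs (x * y) =
        (swapInvolution cs).action (iotaMap cs x) (iotaSigma cs y)) ∧
      (∀ x, iotaSigma cs (HeckeAlgebra.bar x) = (swapInvolution cs).bar (iotaSigma cs x))) ∧
    -- part (b)
    (∀ y w : W, (swapInvolution cs).twistedKLPoly (swapTwisted cs y) (swapTwisted cs w) =
      (klPoly cs y w).comp (Polynomial.X ^ 2)) := by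
  exact ⟨⟨existsUnique_isTwistedAction cs, existsUnique_isTwistedBar cs,
    fun w => existsUnique_isKLFamily w, existsUnique_isTwistedKLFamily cs⟩,
    ⟨iotaMap_injective cs, iotaSigma_bijective cs, iotaMap_mul cs, iotaSigma_mul cs,
      fun x => (bar_iotaSigma cs x).symm⟩, twistedKLPoly_swapTwisted cs⟩
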